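/- Let $\alpha>-1$, let $dA$ be Lebesgue area measure on the unit disk $\mathbb D$ normalized so that $A(\mathbb D)=1$, and let $\omega_\alpha(z)=(1+\alpha)(1-|z|^2)^\alpha$. Write $L^p(\omega_\alpha)$ for $L^p(\mathbb D,\omega_\alpha\,dA)$, and let $L^2_a(\omega_\alpha)$, respectively $L^2_h(\omega_\alpha)$, be the closed subspace of $L^2(\omega_\alpha)$ consisting of the analytic, respectively the complex-valued harmonic, functions on $\mathbb D$. For $z,\lambda\in\mathbb D$ put $$K^\alpha_z(\lambda)=\frac{1}{(1-\overline z\lambda)^{2+\alpha}},\qquad R^\alpha_z(\lambda)=K^\alpha_z(\lambda)+\overline{K^\alpha_z(\lambda)}-1 .$$ Let $\varphi\in L^\infty(\omega_\alpha)$ with $\varphi\ge 0$ almost everywhere (for example, a nonnegative bounded measurable function on $\mathbb D$). Let $\mathbb T_\varphi$ be the Toeplitz operator $f\mapsto P_a(\varphi f)$ on $L^2_a(\omega_\alpha)$ and $T_\varphi$ the Toeplitz operator $f\mapsto P_h(\varphi f)$ on $L^2_h(\omega_\alpha)$, where $P_a$ and $P_h$ are the orthogonal projections of $L^2(\omega_\alpha)$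 onto $L^2_a(\omega_\alpha)$ and $L^2_h(\omega_\alpha)$. Define the Berezin transforms $$\widehat\varphi(z)=\frac{\int_{\mathbb D}\varphi\,|K^\alpha_z|^2\,\omega_\alpha\,dA}{\int_{\mathbb D}|K^\alpha_z|^2\,\omega_\alpha\,dA},\qquad \widetilde\varphi(z)=\frac{\int_{\mathbb D}\varphi\,|R^\alpha_z|^2\,\omega_\alpha\,dA}{\int_{\mathbb D}|R^\alpha_z|^2\,\omega_\alpha\,dA}\qquad(z\in\mathbb D).$$ Then the following four conditions are equivalent: 1. $\mathbb T_\varphi$ is invertible (as a bounded operator) on $L^2_a(\omega_\alpha)$; 2. $T_\varphi$ is invertible (as a bounded operator) on $L^2_h(\omega_\alpha)$; 3. $\widehat\varphi$ is invertible in the algebra $L^\infty(\omega_\alpha)$; 4. $\widetilde\varphi$ is invertible in the algebra $L^\infty(\omega_\alpha)$. -/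

import Mathlib

open MeasureTheory Metric Set Filter Topology InnerProductSpace
open scoped ENNReal ComplexConjugate

noncomputable section

namespace BergmanToeplitz

/-! ### The weighted measure, the Bergman spaces -/

/-- The standard weight `ω_α(z) = (1 + α) (1 - |z|²)^α`. -/
def weight (α : ℝ) (z : ℂ) : ℝ := (1 + α) * (1 - ‖z‖ ^ 2) ^ α

/-- Normalized area measure `dA` on the open unit disk, as a measure on `ℂ` carried by the disk. -/
def areaMeasure : Measure ℂ := ENNReal.ofReal Real.pi⁻¹ • volume.restrict (ball (0 : ℂ) 1)

/-- The measure `ω_α dA` on the open unit disk, as a measure on `ℂ` carried by the disk. -/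
def weightedMeasure (α : ℝ) : Measure ℂ :=
  areaMeasure.withDensity fun z => ENNReal.ofReal (weight α z)

theorem ae_mem_ball (α : ℝ) : ∀ᵐ z ∂(weightedMeasure α), z ∈ ball (0 : ℂ) 1 := by
  have h1 : weightedMeasure α ≪ volume.restrict (ball (0 : ℂ) 1) :=
    (withDensity_absolutelyContinuous _ _).trans Measure.smul_absolutelyContinuous
  exact h1.ae_le (ae_restrict_mem measurableSet_ball)

/-- The Bergman space `L²_a(ω_α)`: the subspace of `L²(ω_α)` of the (classes of) functions that are
analytic on the unit disk. -/
def analyticBergman (α : ℝ) : Submodule ℂ (Lp ℂ 2 (weightedMeasure α)) where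
  carrier := {f | ∃ g : ℂ → ℂ, DifferentiableOn ℂ g (ball 0 1) ∧ f =ᵐ[weightedMeasure α] g}
  zero_mem' := ⟨0, differentiableOn_const 0, Lp.coeFn_zero _ _ _⟩
  add_mem' := by
    rintro f₁ f₂ ⟨g₁, h₁, e₁⟩ ⟨g₂, h₂, e₂⟩
    exact ⟨g₁ + g₂, h₁.add h₂, (Lp.coeFn_add _ _).trans (e₁.add e₂)⟩
  smul_mem' := by
    rintro c f ⟨g, h, e⟩
    exact ⟨c • g, h.const_smul c, (Lp.coeFn_smul _ _).trans (e.const_smul c)⟩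

/-- The harmonic Bergman space `L²_h(ω_α)`: the subspace of `L²(ω_α)` of the (classes of)
complex-valued functions that are harmonic on the unit disk. -/
def harmonicBergman (α : ℝ) : Submodule ℂ (Lp ℂ 2 (weightedMeasure α)) where
  carrier := {f | ∃ g : ℂ → ℂ, HarmonicOnNhd g (ball 0 1) ∧ f =ᵐ[weightedMeasure α] g}
  zero_mem' := ⟨0, harmonicOnNhd_const 0, Lp.coeFn_zero _ _ _⟩
  add_mem' := by
    rintro f₁ f₂ ⟨g₁, h₁, e₁⟩ ⟨g₂, h₂, e₂⟩
    exact ⟨g₁ + g₂, h₁.add h₂, (Lp.coeFn_add _ _).trans (e₁.add e₂)⟩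
  smul_mem' := by
    rintro c f ⟨g, h, e⟩
    exact ⟨c • g, h.comp_CLM ((c • ContinuousLinearMap.id ℂ ℂ).restrictScalars ℝ),
      (Lp.coeFn_smul _ _).trans (e.const_smul c)⟩

/-! ### Completeness of the Bergman spaces -/

/-- A limit of real harmonic functions on the disk, uniform on smaller closed disks, is harmonic. -/
theorem harmonicOnNhd_of_tendstoUniformlyOn {u : ℕ → ℂ → ℝ} {v : ℂ → ℝ}
    (hu : ∀ n, HarmonicOnNhd (u n) (ball 0 1))
    (huv : ∀ R < 1, TendstoUniformlyOn u v atTop (closedBall 0 R)) :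
    HarmonicOnNhd v (ball 0 1) := by
  intro x hx
  have hx1 : ‖x‖ < 1 := by simpa using hx
  obtain ⟨R, hxR, hR1⟩ := exists_between hx1
  have hR0 : 0 < R := (norm_nonneg x).trans_lt hxR
  have hsub : closedBall (0 : ℂ) R ⊆ ball 0 1 := closedBall_subset_ball hR1
  have hvc : ContinuousOn v (closedBall 0 R) :=
    (huv R hR1).continuousOn (Frequently.of_forall fun n => ((hu n).continuousOn).mono hsub)
  have hvi : CircleIntegrable v 0 R := by
    refine ContinuousOn.circleIntegrable hR0.le (hvc.mono sphere_subset_closedBall)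
  have hvi' : CircleIntegrable (fun ζ => (v ζ : ℂ)) 0 R := by
    refine ContinuousOn.circleIntegrable hR0.le ?_
    exact Complex.continuous_ofReal.comp_continuousOn (hvc.mono sphere_subset_closedBall)
  have key : ∀ w ∈ ball (0 : ℂ) R,
      v w = (Real.circleAverage (fun ζ ↦ herglotzRieszKernel 0 w ζ • (v ζ : ℂ)) 0 R).re := by
    intro w hw
    rw [re_circleAverage_herglotzRieszKernel_smul hvi hw]
    have h1 : ∀ n, Real.circleAverage ((Complex.re ∘ herglotzRieszKernel 0 w) • u n) 0 R = u n w :=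
      fun n => HarmonicOnNhd.circleAverage_re_herglotzRieszKernel_smul ((hu n).mono hsub) hw
    have h2 : Tendsto (fun n => u n w) atTop (𝓝 (v w)) :=
      (huv R hR1).tendsto_at (ball_subset_closedBall hw)
    refine tendsto_nhds_unique h2 ?_
    have hk : ContinuousOn (Complex.re ∘ herglotzRieszKernel 0 w) (sphere 0 R) := by
      have := continuousOn_herglotzRieszKernel_sphere hw
      rw [abs_of_pos hR0] at this
      exact Complex.continuous_re.comp_continuousOn this
    obtain ⟨M, hM⟩ := (isCompact_sphere (0 : ℂ) R).exists_bound_of_continuousOn hk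
    have hM0 : 0 ≤ M := (norm_nonneg _).trans (hM (R : ℂ) (by simp [abs_of_pos hR0]))
    simp_rw [← h1]
    have hint : ∀ f : ℂ → ℝ, ContinuousOn f (closedBall 0 R) →
        CircleIntegrable ((Complex.re ∘ herglotzRieszKernel 0 w) • f) 0 R := fun f hf =>
      ContinuousOn.circleIntegrable hR0.le (hk.smul (hf.mono sphere_subset_closedBall))
    rw [Metric.tendsto_nhds]
    intro ε hε
    have h3 := Metric.tendstoUniformlyOn_iff.1 (huv R hR1) (ε / (M + 1)) (by positivity)
    filter_upwards [h3] with n hn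
    rw [dist_eq_norm, ← Real.circleAverage_sub (hint _ ((hu n).continuousOn.mono hsub)) (hint _ hvc)]
    rw [Real.norm_eq_abs]
    refine Real.abs_circleAverage_le_circleAverage_abs.trans_lt ?_
    refine lt_of_le_of_lt (b := M * (ε / (M + 1))) ?_ ?_
    · refine Real.circleAverage_mono_on_of_le_circle ?_ ?_
      · exact ((hint _ ((hu n).continuousOn.mono hsub)).sub (hint _ hvc)).abs
      · intro ζ hζ
        rw [abs_of_pos hR0] at hζ
        have h4 := hn ζ (sphere_subset_closedBall hζ)
        have h5 := hM ζ hζ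
        simp only [Pi.abs_apply, Pi.mul_apply, Pi.sub_apply, smul_eq_mul, ← mul_sub, abs_mul]
        rw [dist_comm, Real.dist_eq] at h4
        exact mul_le_mul h5 h4.le (abs_nonneg _) hM0
    · rw [mul_div_assoc', div_lt_iff₀ (by positivity)]
      nlinarith
  have han := analyticOnNhd_circleAverage_herglotzRieszKernel_smul hvi'
  have hxb : x ∈ ball (0 : ℂ) R := by simpa using hxR
  refine (harmonicAt_congr_nhds ?_).2 (han x hxb).harmonicAt_re
  filter_upwards [isOpen_ball.mem_nhds hxb] with w hw using key w hw

/-- The sub-mean-value inequality over disks for complex-valued harmonic functions. -/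
theorem enorm_mul_le_lintegral_closedBall {f : ℂ → ℂ} (hf : HarmonicOnNhd f (ball 0 1)) {z : ℂ} {r : ℝ}
    (h : closedBall z r ⊆ ball 0 1) :
    ‖f z‖ₑ * (ENNReal.ofReal (2 * Real.pi) * ∫⁻ s in Ioo 0 r, ENNReal.ofReal s)
      ≤ ∫⁻ w in closedBall z r, ‖f w‖ₑ := by
  classical
  set g : ℂ → ℝ≥0∞ := (closedBall z r).indicator fun w => ‖f w‖ₑ with hg
  have hfc := hf.continuousOn.mono h
  have hgm : Measurable g := by
    rw [hg, ← Set.piecewise_eq_indicator]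
    exact ContinuousOn.measurable_piecewise hfc.enorm continuousOn_const measurableSet_closedBall
  have hcircle : ∀ s ∈ Ioo 0 r, ‖f z‖ₑ * ENNReal.ofReal (2 * Real.pi) ≤
      ∫⁻ θ in Ioo (-Real.pi) Real.pi, g (z + Complex.polarCoord.symm (s, θ)) := by
    intro s hs
    have h1 : Real.circleAverage f z s = f z := by
      apply InnerProductSpace.HarmonicOnNhd.circleAverage_eq
      rw [abs_of_pos hs.1]
      exact hf.mono ((closedBall_subset_closedBall hs.2.le).trans h)
    have h2 : ∫ θ in Ioo (-Real.pi) Real.pi, f (circleMap z s θ) = ((2 * Real.pi : ℝ)) • f z := by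
      rw [← h1, Real.circleAverage_def, smul_smul, mul_inv_cancel₀ (by positivity), one_smul,
        ← integral_Ioc_eq_integral_Ioo, ← intervalIntegral.integral_of_le (by linarith [Real.pi_pos])]
      have hp : Function.Periodic (fun θ => f (circleMap z s θ)) (2 * Real.pi) := fun θ => by
        simp only [periodic_circleMap z s θ]
      have := hp.intervalIntegral_add_eq (-Real.pi) 0
      rw [zero_add, show -Real.pi + 2 * Real.pi = Real.pi by ring] at this
      exact this
    have h3 : ‖f z‖ₑ * ENNReal.ofReal (2 * Real.pi) =
        ‖∫ θ in Ioo (-Real.pi) Real.pi, f (circleMap z s θ)‖ₑ := by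
      rw [h2, enorm_smul, mul_comm, Real.enorm_of_nonneg (by positivity)]
    rw [h3]
    refine (enorm_integral_le_lintegral_enorm _).trans (le_of_eq ?_)
    refine lintegral_congr fun θ => ?_
    have h4 : z + Complex.polarCoord.symm (s, θ) = circleMap z s θ := by
      rw [circleMap, Complex.polarCoord_symm_apply, Complex.exp_mul_I]
      push_cast
      rfl
    rw [h4, hg, indicator_of_mem]
    exact closedBall_subset_closedBall hs.2.le (circleMap_mem_closedBall z hs.1.le θ)
  calc ‖f z‖ₑ * (ENNReal.ofReal (2 * Real.pi) * ∫⁻ s in Ioo 0 r, ENNReal.ofReal s)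
      = ∫⁻ s in Ioo 0 r, ENNReal.ofReal s * (‖f z‖ₑ * ENNReal.ofReal (2 * Real.pi)) := by
        rw [lintegral_mul_const _ (by fun_prop)]; ring
    _ ≤ ∫⁻ s in Ioo 0 r, ENNReal.ofReal s *
          ∫⁻ θ in Ioo (-Real.pi) Real.pi, g (z + Complex.polarCoord.symm (s, θ)) := by
        refine setLIntegral_mono' measurableSet_Ioo fun s hs => ?_
        gcongr
        exact hcircle s hs
    _ ≤ ∫⁻ s in Ioi 0, ENNReal.ofReal s *
          ∫⁻ θ in Ioo (-Real.pi) Real.pi, g (z + Complex.polarCoord.symm (s, θ)) :=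
        lintegral_mono_set fun s hs => hs.1
    _ = ∫⁻ s in Ioi 0, ∫⁻ θ in Ioo (-Real.pi) Real.pi,
          ENNReal.ofReal s • g (z + Complex.polarCoord.symm (s, θ)) := by
        refine lintegral_congr fun s => ?_
        simp only [smul_eq_mul]
        rw [lintegral_const_mul' _ _ ENNReal.ofReal_ne_top]
    _ = ∫⁻ p in polarCoord.target, ENNReal.ofReal p.1 • g (z + Complex.polarCoord.symm p) := by
        have hm : Measurable fun p : ℝ × ℝ =>
            ENNReal.ofReal p.1 • g (z + Complex.polarCoord.symm p) := by
          simp only [Complex.polarCoord_symm_apply, smul_eq_mul]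
          refine Measurable.mul (by fun_prop) (hgm.comp (by fun_prop))
        rw [polarCoord_target, Measure.volume_eq_prod, ← Measure.prod_restrict,
          lintegral_prod _ hm.aemeasurable]
    _ = ∫⁻ w, g (z + w) := Complex.lintegral_comp_polarCoord_symm fun w => g (z + w)
    _ = ∫⁻ w, g w := lintegral_add_left_eq_self g z
    _ = _ := by rw [hg, lintegral_indicator measurableSet_closedBall]

theorem exists_restrict_le {α : ℝ} (hα : -1 < α) {R : ℝ} (hR : R < 1) :
    ∃ C : ℝ≥0∞, C ≠ ∞ ∧ (volume : Measure ℂ).restrict (closedBall 0 R) ≤ C • weightedMeasure α := by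
  have hsub : closedBall (0 : ℂ) R ⊆ ball 0 1 := closedBall_subset_ball hR
  have hpos : ∀ z ∈ closedBall (0 : ℂ) R, 0 < 1 - ‖z‖ ^ 2 := by
    intro z hz
    have h1 : ‖z‖ < 1 := by simpa using hsub hz
    nlinarith [norm_nonneg z]
  have hwpos : ∀ z ∈ closedBall (0 : ℂ) R, 0 < weight α z := fun z hz =>
    mul_pos (by linarith) (Real.rpow_pos_of_pos (hpos z hz) _)
  have hwc : ContinuousOn (weight α) (closedBall 0 R) := by
    unfold weight
    refine continuousOn_const.mul (ContinuousOn.rpow_const (by fun_prop) fun z hz => ?_)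
    exact Or.inl (hpos z hz).ne'
  obtain ⟨c, hc, hcw⟩ : ∃ c > 0, ∀ z ∈ closedBall (0 : ℂ) R, c ≤ weight α z := by
    rcases (closedBall (0 : ℂ) R).eq_empty_or_nonempty with he | hne
    · exact ⟨1, one_pos, by simp [he]⟩
    · obtain ⟨z₀, hz₀, hmin⟩ := (isCompact_closedBall (0 : ℂ) R).exists_isMinOn hne hwc
      exact ⟨_, hwpos z₀ hz₀, fun z hz => hmin hz⟩
  refine ⟨ENNReal.ofReal (Real.pi / c), ENNReal.ofReal_ne_top, Measure.le_iff.2 fun s hs => ?_⟩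
  rw [Measure.smul_apply, smul_eq_mul, weightedMeasure, withDensity_apply _ hs, areaMeasure,
    Measure.restrict_smul, lintegral_smul_measure, Measure.restrict_restrict hs,
    Measure.restrict_apply hs, smul_eq_mul]
  calc volume (s ∩ closedBall 0 R)
      = ENNReal.ofReal (Real.pi / c) * (ENNReal.ofReal Real.pi⁻¹ *
          (ENNReal.ofReal c * volume (s ∩ closedBall 0 R))) := by
        rw [← mul_assoc, ← mul_assoc, ← ENNReal.ofReal_mul (by positivity),
          ← ENNReal.ofReal_mul (by positivity)]
        rw [show Real.pi / c * Real.pi⁻¹ * c = 1 by field_simp]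
        simp
    _ ≤ _ := by
        gcongr
        rw [← setLIntegral_const]
        refine (setLIntegral_mono' (hs.inter measurableSet_closedBall) fun z hz =>
          ENNReal.ofReal_le_ofReal (hcw z hz.2)).trans ?_
        exact lintegral_mono_set (inter_subset_inter_right s hsub)

/-- Point evaluations are bounded, uniformly on smaller closed disks. -/
theorem exists_enorm_le_eLpNorm {α : ℝ} (hα : -1 < α) {R : ℝ} (hR : R < 1) :
    ∃ C : ℝ≥0∞, C ≠ ∞ ∧ ∀ g : ℂ → ℂ, HarmonicOnNhd g (ball 0 1) → ∀ z ∈ closedBall (0 : ℂ) R,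
      ‖g z‖ₑ ≤ C * eLpNorm g 2 (weightedMeasure α) := by
  obtain ⟨R', hRR', hR'⟩ := exists_between hR
  obtain ⟨C, hC, hCle⟩ := exists_restrict_le hα hR'
  set r := R' - R with hr
  have hr0 : 0 < r := by linarith
  set I : ℝ≥0∞ := ENNReal.ofReal (2 * Real.pi) * ∫⁻ s in Ioo 0 r, ENNReal.ofReal s with hI
  have hI0 : I ≠ 0 := by
    refine mul_ne_zero (by simp [Real.pi_pos]) ?_
    rw [← pos_iff_ne_zero, setLIntegral_pos_iff (by fun_prop)]
    have : (Function.support fun s : ℝ => ENNReal.ofReal s) ∩ Ioo 0 r = Ioo 0 r := by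
      ext s
      simp only [mem_inter_iff, Function.mem_support, mem_Ioo, ne_eq, ENNReal.ofReal_eq_zero, not_le]
      tauto
    rw [this]
    simpa using hr0
  have hIt : I ≠ ∞ := by
    refine ENNReal.mul_ne_top ENNReal.ofReal_ne_top (ne_top_of_le_ne_top ?_
      (setLIntegral_mono' (g := fun _ => ENNReal.ofReal r) measurableSet_Ioo fun s hs =>
        ENNReal.ofReal_le_ofReal hs.2.le))
    rw [setLIntegral_const]
    exact ENNReal.mul_ne_top ENNReal.ofReal_ne_top (by simp)
  set V : ℝ≥0∞ := (volume.restrict (closedBall (0 : ℂ) R') : Measure ℂ) univ with hV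
  have hVt : V ≠ ∞ := by
    rw [hV, Measure.restrict_apply_univ]
    exact measure_closedBall_lt_top.ne
  refine ⟨I⁻¹ * (C ^ (1 / 2 : ℝ) * V ^ (1 / 2 : ℝ)), ?_, fun g hg z hz => ?_⟩
  · refine ENNReal.mul_ne_top (ENNReal.inv_ne_top.2 hI0) (ENNReal.mul_ne_top ?_ ?_)
    · exact ENNReal.rpow_ne_top_of_nonneg (by norm_num) hC
    · exact ENNReal.rpow_ne_top_of_nonneg (by norm_num) hVt
  · have hsub : closedBall z r ⊆ closedBall 0 R' := by
      refine closedBall_subset_closedBall' ?_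
      have := mem_closedBall.1 hz
      linarith
    have hsub' : closedBall (0 : ℂ) R' ⊆ ball 0 1 := closedBall_subset_ball hR'
    have hmeas : AEStronglyMeasurable g (volume.restrict (closedBall (0 : ℂ) R')) :=
      (hg.continuousOn.mono hsub').aestronglyMeasurable measurableSet_closedBall
    have h1 := enorm_mul_le_lintegral_closedBall hg (hsub.trans hsub')
    have h2 : ∫⁻ w in closedBall z r, ‖g w‖ₑ ≤
        C ^ (1 / 2 : ℝ) * V ^ (1 / 2 : ℝ) * eLpNorm g 2 (weightedMeasure α) := by
      calc ∫⁻ w in closedBall z r, ‖g w‖ₑ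
          ≤ ∫⁻ w in closedBall 0 R', ‖g w‖ₑ := lintegral_mono_set hsub
        _ = eLpNorm g 1 (volume.restrict (closedBall 0 R')) := eLpNorm_one_eq_lintegral_enorm.symm
        _ ≤ eLpNorm g 2 (volume.restrict (closedBall 0 R')) * V ^ (1 / 2 : ℝ) := by
          refine (eLpNorm_le_eLpNorm_mul_rpow_measure_univ (q := 2) (by norm_num) hmeas).trans_eq ?_
          rw [← hV]
          norm_num
        _ ≤ C ^ (1 / 2 : ℝ) * eLpNorm g 2 (weightedMeasure α) * V ^ (1 / 2 : ℝ) := by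
          gcongr
          refine (eLpNorm_mono_measure g hCle).trans ?_
          rw [eLpNorm_smul_measure_of_ne_top (by norm_num), smul_eq_mul]
          norm_num
        _ = _ := by ring
    rw [mul_assoc, ← ENNReal.div_eq_inv_mul, ENNReal.le_div_iff_mul_le (Or.inl hI0) (Or.inl hIt)]
    exact h1.trans h2

theorem isClosed_of_limit (α : ℝ) (P : (ℂ → ℂ) → Prop)
    (hP : ∀ g, P g → HarmonicOnNhd g (ball 0 1))
    (hlim : ∀ (u : ℕ → ℂ → ℂ) (v : ℂ → ℂ), (∀ n, P (u n)) →
      (∀ R < 1, TendstoUniformlyOn u v atTop (closedBall 0 R)) → P v) :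
    IsClosed {f : Lp ℂ 2 (weightedMeasure α) | ∃ g, P g ∧ f =ᵐ[weightedMeasure α] g} := by
  rcases le_or_gt α (-1) with hα | hα
  · have h0 : weightedMeasure α = 0 := by
      rw [weightedMeasure, withDensity_eq_zero_iff (by unfold weight; fun_prop)]
      have h1 : areaMeasure ≪ volume.restrict (ball (0 : ℂ) 1) :=
        Measure.smul_absolutelyContinuous
      filter_upwards [h1.ae_le (ae_restrict_mem measurableSet_ball)] with z hz
      have h2 : ‖z‖ < 1 := by simpa using hz
      have h3 : 0 ≤ (1 - ‖z‖ ^ 2) ^ α := Real.rpow_nonneg (by nlinarith [norm_nonneg z]) _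
      exact ENNReal.ofReal_of_nonpos (mul_nonpos_of_nonpos_of_nonneg (by linarith) h3)
    have : Subsingleton (Lp ℂ 2 (weightedMeasure α)) := by
      refine ⟨fun f g => Lp.ext ?_⟩
      have h1 : ae (weightedMeasure α) = ⊥ := by rw [h0, ae_zero]
      rw [EventuallyEq, h1]
      exact eventually_bot
    exact isClosed_discrete _
  · refine IsSeqClosed.isClosed fun f f₀ hf hff₀ => ?_
    choose g hgP hfg using hf
    have hcauchy : ∀ R < 1, UniformCauchySeqOn g atTop (closedBall 0 R) := by
      intro R hR
      obtain ⟨C, hC, hCle⟩ := exists_enorm_le_eLpNorm hα hR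
      rw [Metric.uniformCauchySeqOn_iff]
      intro ε₀ hε₀
      obtain ⟨ε, hε, hεε⟩ : ∃ ε > 0, ε = ENNReal.ofReal ε₀ := ⟨_, by simpa using hε₀, rfl⟩
      have hε' : 0 < ε / (C + 1) := ENNReal.div_pos hε.ne' (by simp [hC])
      obtain ⟨N, hN⟩ := EMetric.cauchySeq_iff.1 hff₀.cauchySeq (ε / (C + 1)) hε'
      refine ⟨N, fun m hm n hn z hz => ?_⟩
      have h1 := hCle (g m - g n) ((hP _ (hgP m)).sub (hP _ (hgP n))) z hz
      have h2 : eLpNorm (g m - g n) 2 (weightedMeasure α) = edist (f m) (f n) := by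
        rw [Lp.edist_def]
        exact (eLpNorm_congr_ae ((hfg m).sub (hfg n))).symm
      rw [h2] at h1
      rw [← edist_lt_ofReal, ← hεε, edist_eq_enorm_sub]
      refine lt_of_le_of_lt (h1.trans (mul_le_mul_left (le_self_add (b := 1)) _)) ?_
      have := hN m hm n hn
      rw [mul_comm]
      exact (ENNReal.lt_div_iff_mul_lt (Or.inl (by simp)) (Or.inl (by simp [hC]))).1 this
    have hpt : ∀ z : ℂ, ∃ y, z ∈ ball (0 : ℂ) 1 → Tendsto (fun n => g n z) atTop (𝓝 y) := by
      intro z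
      by_cases hz : z ∈ ball (0 : ℂ) 1
      · have hz' : ‖z‖ < 1 := by simpa using hz
        obtain ⟨y, hy⟩ := cauchySeq_tendsto_of_complete
          ((hcauchy ‖z‖ hz').cauchySeq (x := z) (by simp))
        exact ⟨y, fun _ => hy⟩
      · exact ⟨0, fun h => (hz h).elim⟩
    choose v hv using hpt
    have huv : ∀ R < 1, TendstoUniformlyOn g v atTop (closedBall 0 R) := fun R hR =>
      (hcauchy R hR).tendstoUniformlyOn_of_tendsto fun z hz =>
        hv z (closedBall_subset_ball hR hz)
    refine ⟨v, hlim g v hgP huv, ?_⟩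
    obtain ⟨ns, hns, hae⟩ := (tendstoInMeasure_of_tendsto_Lp hff₀).exists_seq_tendsto_ae
    filter_upwards [hae, ae_all_iff.2 hfg, ae_mem_ball α] with z h1 h2 h3
    refine tendsto_nhds_unique h1 ?_
    simp only [h2]
    exact (hv z h3).comp hns.tendsto_atTop

theorem isClosed_analyticBergman (α : ℝ) :
    IsClosed (analyticBergman α : Set (Lp ℂ 2 (weightedMeasure α))) := by
  refine isClosed_of_limit α (fun g => DifferentiableOn ℂ g (ball 0 1))
    (fun g hg z hz => (hg.analyticAt (isOpen_ball.mem_nhds hz)).harmonicAt) fun u v hu huv => ?_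
  refine TendstoLocallyUniformlyOn.differentiableOn (φ := atTop) (F := u) ?_
    (Eventually.of_forall hu) isOpen_ball
  rw [tendstoLocallyUniformlyOn_iff_forall_isCompact isOpen_ball]
  intro K hK hKc
  obtain ⟨R, hR, hKR⟩ : ∃ R < 1, K ⊆ closedBall (0 : ℂ) R := by
    rcases K.eq_empty_or_nonempty with rfl | hne
    · exact ⟨0, one_pos, empty_subset _⟩
    · obtain ⟨z₀, hz₀, hmax⟩ := hKc.exists_isMaxOn hne (continuous_norm.continuousOn)
      exact ⟨‖z₀‖, by simpa using hK hz₀, fun z hz => by simpa using hmax hz⟩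
  exact (huv R hR).mono hKR

theorem isClosed_harmonicBergman (α : ℝ) :
    IsClosed (harmonicBergman α : Set (Lp ℂ 2 (weightedMeasure α))) := by
  refine isClosed_of_limit α (fun g => HarmonicOnNhd g (ball 0 1)) (fun g hg => hg)
    fun u v hu huv => ?_
  have hre : HarmonicOnNhd (Complex.reCLM ∘ v) (ball 0 1) :=
    harmonicOnNhd_of_tendstoUniformlyOn (fun n => (hu n).comp_CLM Complex.reCLM) fun R hR =>
      Complex.reCLM.uniformContinuous.comp_tendstoUniformlyOn (huv R hR)
  have him : HarmonicOnNhd (Complex.imCLM ∘ v) (ball 0 1) :=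
    harmonicOnNhd_of_tendstoUniformlyOn (fun n => (hu n).comp_CLM Complex.imCLM) fun R hR =>
      Complex.imCLM.uniformContinuous.comp_tendstoUniformlyOn (huv R hR)
  have h := (hre.comp_CLM Complex.ofRealCLM).add
    (him.comp_CLM ((Complex.I • ContinuousLinearMap.id ℂ ℂ).restrictScalars ℝ ∘L Complex.ofRealCLM))
  convert h using 1
  ext z
  simp [mul_comm Complex.I]

instance completeSpace_analyticBergman (α : ℝ) : CompleteSpace (analyticBergman α) :=
  (isClosed_analyticBergman α).completeSpace_coe

instance completeSpace_harmonicBergman (α : ℝ) : CompleteSpace (harmonicBergman α) :=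
  (isClosed_harmonicBergman α).completeSpace_coe

/-! ### Toeplitz operators, Berezin transforms, invertibility in `L^∞` -/

/-- Multiplication by `φ ∈ L^∞(ω_α)` as a bounded operator on `L²(ω_α)`. -/
def mulOperator (α : ℝ) (φ : ℂ → ℝ) (hφ : MemLp φ ∞ (weightedMeasure α)) :
    Lp ℂ 2 (weightedMeasure α) →L[ℂ] Lp ℂ 2 (weightedMeasure α) :=
  (ContinuousLinearMap.mul ℂ ℂ).holderL (weightedMeasure α) ∞ 2 2
    ((hφ.ofReal (K := ℂ)).toLp fun z => (φ z : ℂ))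

/-- The Toeplitz operator `f ↦ P (φ f)` on `L²_a(ω_α)`, where `P` is the orthogonal projection of
`L²(ω_α)` onto `L²_a(ω_α)`. -/
def analyticToeplitz (α : ℝ) (φ : ℂ → ℝ) (hφ : MemLp φ ∞ (weightedMeasure α)) :
    analyticBergman α →L[ℂ] analyticBergman α :=
  (analyticBergman α).orthogonalProjectionOnto ∘L mulOperator α φ hφ ∘L (analyticBergman α).subtypeL

/-- The Toeplitz operator `f ↦ Q (φ f)` on `L²_h(ω_α)`, where `Q` is the orthogonal projection of
`L²(ω_α)` onto `L²_h(ω_α)`. -/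
def harmonicToeplitz (α : ℝ) (φ : ℂ → ℝ) (hφ : MemLp φ ∞ (weightedMeasure α)) :
    harmonicBergman α →L[ℂ] harmonicBergman α :=
  (harmonicBergman α).orthogonalProjectionOnto ∘L mulOperator α φ hφ ∘L (harmonicBergman α).subtypeL

/-- The reproducing kernel `K^α_z(w) = (1 - z̄ w)^{-(2+α)}` of `L²_a(ω_α)` (principal branch; the
base has positive real part for `z`, `w` in the disk). -/
def analyticKernel (α : ℝ) (z w : ℂ) : ℂ := 1 / (1 - conj z * w) ^ ((2 + α : ℝ) : ℂ)

/-- The reproducing kernel `R^α_z = K^α_z + conj K^α_z - 1` of `L²_h(ω_α)`. -/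
def harmonicKernel (α : ℝ) (z w : ℂ) : ℂ := analyticKernel α z w + conj (analyticKernel α z w) - 1

/-- The Berezin transform `φ̂(z) = ‖K^α_z‖⁻² ∫ φ |K^α_z|² ω_α dA`. -/
def analyticBerezin (α : ℝ) (φ : ℂ → ℝ) (z : ℂ) : ℝ :=
  (∫ w, φ w * ‖analyticKernel α z w‖ ^ 2 ∂(weightedMeasure α)) /
    ∫ w, ‖analyticKernel α z w‖ ^ 2 ∂(weightedMeasure α)

/-- The Berezin transform `φ̃(z) = ‖R^α_z‖⁻² ∫ φ |R^α_z|² ω_α dA`. -/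
def harmonicBerezin (α : ℝ) (φ : ℂ → ℝ) (z : ℂ) : ℝ :=
  (∫ w, φ w * ‖harmonicKernel α z w‖ ^ 2 ∂(weightedMeasure α)) /
    ∫ w, ‖harmonicKernel α z w‖ ^ 2 ∂(weightedMeasure α)

/-- `ψ` belongs to the algebra `L^∞(ω_α)` and has a multiplicative inverse in it. -/
def InvertibleInLinfty (α : ℝ) (ψ : ℂ → ℝ) : Prop :=
  MemLp ψ ∞ (weightedMeasure α) ∧ ∃ g : ℂ → ℂ, MemLp g ∞ (weightedMeasure α) ∧
    ∀ᵐ z ∂(weightedMeasure α), (ψ z : ℂ) * g z = 1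

end BergmanToeplitz

end

/-!
A positive operator on a Hilbert space is invertible if and only if its quadratic form is bounded
below, so each Toeplitz operator is invertible if and only if `∫ |f|² dμ ≤ C ∫ φ |f|² dμ` for all `f`
in the corresponding Bergman space, where `dμ = ω_α dA` (`isUnit_compression_iff`). The inequality
passes from the harmonic space to its analytic subspace, and testing it on the kernels `K_z` and `R_z`
bounds the Berezin transforms below. The harmonic Berezin transform is dominated by the analytic one,
because `|R_z| ≤ C |K_z|` pointwise and `‖K_z‖ ≤ ‖R_z‖` by the mean value property
(`lintegral_enorm_analyticKernel_sq_le`).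

There remains the passage from a lower bound on `φ̂` to the inequality for harmonic functions. Let
`m_z` be the disk automorphism exchanging `0` and `z`. Up to a constant, `φ̂(z)` is the integral of
`φ ∘ m_z` against `μ` (`lintegral_comp_mob`), so these integrals are at least some `δ > 0`. A
compactness argument (`exists_enorm_zero_sq_le`) gives, for every `ε > 0`, a constant `C` such that
`|F(0)|² ≤ ε ∫ |F|² dν + C ∫ g |F|² dν` for all harmonic `F` and all densities `0 ≤ g ≤ B` with
`∫ g dμ ≥ δ`, where `ν` is any other standard weighted measure: a weak limit of normalized
counterexamples would be a harmonic function with value `1` at the origin, hence nonzero almost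
everywhere, which is incompatible with `∫ g dμ ≥ δ`. This is applied to `F = f ∘ m_z`, `g = φ ∘ m_z`, and
integrated over `z` with respect to `μ`. For the weight exponent `2 α + 2` of `ν` the averaging operator
`h ↦ ∫ h ∘ m_z dν` is bounded on `L¹(μ)` (`exists_lintegral_lintegral_comp_mob_le`), whence
`∫ |f|² dμ ≤ C₁ ε ∫ |f|² dμ + C₁ C ∫ φ |f|² dμ`, and a small `ε` lets the first term be absorbed.
-/

noncomputable section

namespace BergmanToeplitz

/-! ### The weighted measure -/

theorem norm_lt_one_of_mem {z : ℂ} (hz : z ∈ ball (0 : ℂ) 1) : ‖z‖ < 1 := by simpa using hz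

theorem one_sub_norm_sq_pos {z : ℂ} (hz : z ∈ ball (0 : ℂ) 1) : 0 < 1 - ‖z‖ ^ 2 := by
  nlinarith [norm_lt_one_of_mem hz, norm_nonneg z]

theorem weight_pos {α : ℝ} (hα : -1 < α) {z : ℂ} (hz : z ∈ ball (0 : ℂ) 1) : 0 < weight α z :=
  mul_pos (by linarith) (Real.rpow_pos_of_pos (one_sub_norm_sq_pos hz) _)

@[fun_prop]
theorem measurable_weight (α : ℝ) : Measurable (weight α) := by
  unfold weight; fun_prop

theorem lintegral_weightedMeasure (α : ℝ) {h : ℂ → ℝ≥0∞} (hh : Measurable h) :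
    ∫⁻ z, h z ∂(weightedMeasure α) = ENNReal.ofReal Real.pi⁻¹ *
      ∫⁻ z in ball (0 : ℂ) 1, ENNReal.ofReal (weight α z) * h z := by
  rw [weightedMeasure, lintegral_withDensity_eq_lintegral_mul _ (by fun_prop) hh, areaMeasure,
    lintegral_smul_measure, smul_eq_mul]
  rfl

theorem weightedMeasure_absolutelyContinuous (α : ℝ) :
    weightedMeasure α ≪ volume.restrict (ball (0 : ℂ) 1) :=
  (withDensity_absolutelyContinuous _ _).trans Measure.smul_absolutelyContinuous

theorem restrict_absolutelyContinuous_weightedMeasure {α : ℝ} (hα : -1 < α) :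
    volume.restrict (ball (0 : ℂ) 1) ≪ weightedMeasure α := by
  have h1 : areaMeasure ≪ weightedMeasure α := by
    refine withDensity_absolutelyContinuous' (by fun_prop) ?_
    refine Measure.smul_absolutelyContinuous.ae_le ?_
    filter_upwards [ae_restrict_mem measurableSet_ball] with z hz
    simpa using weight_pos hα hz
  refine Measure.AbsolutelyContinuous.trans ?_ h1
  exact Measure.absolutelyContinuous_smul (by simp [Real.pi_pos])

theorem weightedMeasure_absolutelyContinuous_weightedMeasure (α : ℝ) {β : ℝ} (hβ : -1 < β) :
    weightedMeasure α ≪ weightedMeasure β :=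
  (weightedMeasure_absolutelyContinuous α).trans (restrict_absolutelyContinuous_weightedMeasure hβ)

theorem isFiniteMeasure_weightedMeasure {α : ℝ} (hα : -1 < α) :
    IsFiniteMeasure (weightedMeasure α) := by
  have hint : IntegrableOn (fun y : ℝ => (1 - y) ^ α) (Ioo 0 1) := by
    have h := (intervalIntegral.intervalIntegrable_rpow' (a := 0) (b := 1) hα).comp_sub_left 1
    simp only [sub_zero, sub_self] at h
    exact (intervalIntegrable_iff_integrableOn_Ioo_of_le zero_le_one).1 h.symm
  -- `(1 - y²)^α = (1 + y)^α (1 - y)^α`, and the first factor is bounded on `(0, 1)`.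
  have hint2 : IntegrableOn (fun z : ℂ => (1 - ‖z‖ ^ 2) ^ α) (ball 0 1) := by
    rw [integrableOn_fun_norm_addHaar volume (f := fun y : ℝ => (1 - y ^ 2) ^ α)]
    refine (hint.const_mul (2 ^ |α|)).mono' (by fun_prop) ?_
    filter_upwards [ae_restrict_mem measurableSet_Ioo] with y hy
    have h1 : 0 < 1 - y := by linarith [hy.2]
    have h2 : 1 - y ^ 2 = (1 + y) * (1 - y) := by ring
    have h3 : (1 + y) ^ α ≤ 2 ^ |α| := by
      calc (1 + y) ^ α ≤ (1 + y) ^ |α| :=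
            Real.rpow_le_rpow_of_exponent_le (by linarith [hy.1]) (le_abs_self _)
        _ ≤ 2 ^ |α| := Real.rpow_le_rpow (by linarith [hy.1]) (by linarith [hy.2]) (abs_nonneg _)
    have h4 : 0 ≤ (1 + y) ^ α := Real.rpow_nonneg (by linarith [hy.1]) _
    have h5 : 0 ≤ (1 - y) ^ α := Real.rpow_nonneg h1.le _
    rw [h2, Real.mul_rpow (by linarith [hy.1]) h1.le]
    simp only [Complex.finrank_real_complex, Nat.add_one_sub_one, pow_one, smul_eq_mul, norm_mul,
      Real.norm_eq_abs, abs_of_nonneg h4, abs_of_nonneg h5, abs_of_pos hy.1]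
    calc y * ((1 + y) ^ α * (1 - y) ^ α) ≤ 1 * ((1 + y) ^ α * (1 - y) ^ α) := by
          gcongr; exact hy.2.le
      _ ≤ _ := by rw [one_mul]; gcongr
  have h := (hint2.const_mul (1 + α)).lintegral_lt_top
  refine ⟨?_⟩
  have h1 := lintegral_weightedMeasure α (h := fun _ => 1) measurable_const
  simp only [lintegral_const, one_mul, mul_one] at h1
  rw [h1]
  exact ENNReal.mul_lt_top ENNReal.ofReal_lt_top h

theorem weightedMeasure_univ_ne_zero {α : ℝ} (hα : -1 < α) : weightedMeasure α univ ≠ 0 := by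
  intro h0
  have := restrict_absolutelyContinuous_weightedMeasure hα h0
  rw [Measure.restrict_apply_univ] at this
  exact (measure_ball_pos volume (0 : ℂ) one_pos).ne' this

/-! ### Disk automorphisms and the change of variables -/

/-- The involutive automorphism of the unit disk that exchanges `0` and `z`. -/
def mob (z u : ℂ) : ℂ := (z - u) / (1 - conj z * u)

@[simp] theorem mob_zero_right (z : ℂ) : mob z 0 = z := by simp [mob]

theorem norm_conj_mul_lt_one {z u : ℂ} (hz : z ∈ ball (0 : ℂ) 1) (hu : u ∈ ball (0 : ℂ) 1) :
    ‖conj z * u‖ < 1 := by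
  rw [norm_mul, RCLike.norm_conj]
  nlinarith [norm_lt_one_of_mem hz, norm_lt_one_of_mem hu, norm_nonneg z, norm_nonneg u]

theorem one_sub_conj_mul_ne_zero {z u : ℂ} (hz : z ∈ ball (0 : ℂ) 1) (hu : u ∈ ball (0 : ℂ) 1) :
    1 - conj z * u ≠ 0 := by
  intro h
  have h1 := norm_conj_mul_lt_one hz hu
  rw [← sub_eq_zero.1 h] at h1
  simp at h1

theorem norm_one_sub_conj_mul_pos {z u : ℂ} (hz : z ∈ ball (0 : ℂ) 1) (hu : u ∈ ball (0 : ℂ) 1) :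
    0 < ‖1 - conj z * u‖ := norm_pos_iff.2 (one_sub_conj_mul_ne_zero hz hu)

theorem norm_one_sub_conj_mul_comm (z u : ℂ) : ‖1 - conj z * u‖ = ‖1 - conj u * z‖ := by
  rw [← RCLike.norm_conj]
  simp [mul_comm]

@[fun_prop]
theorem measurable_mob (z : ℂ) : Measurable (mob z) := by unfold mob; fun_prop

theorem one_sub_norm_mob_sq {z u : ℂ} (hz : z ∈ ball (0 : ℂ) 1) (hu : u ∈ ball (0 : ℂ) 1) :
    1 - ‖mob z u‖ ^ 2 = (1 - ‖z‖ ^ 2) * (1 - ‖u‖ ^ 2) / ‖1 - conj z * u‖ ^ 2 := by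
  have h := norm_one_sub_conj_mul_pos hz hu
  rw [mob, norm_div, div_pow, eq_div_iff (by positivity), sub_mul, div_mul_cancel₀ _ (by positivity)]
  simp only [← Complex.normSq_eq_norm_sq, Complex.normSq_apply]
  simp
  ring

theorem mob_mem {z u : ℂ} (hz : z ∈ ball (0 : ℂ) 1) (hu : u ∈ ball (0 : ℂ) 1) :
    mob z u ∈ ball (0 : ℂ) 1 := by
  have h := norm_one_sub_conj_mul_pos hz hu
  have h1 := one_sub_norm_mob_sq hz hu
  have h2 : 0 < 1 - ‖mob z u‖ ^ 2 := by
    rw [h1]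
    exact div_pos (mul_pos (one_sub_norm_sq_pos hz) (one_sub_norm_sq_pos hu)) (by positivity)
  have : ‖mob z u‖ < 1 := by nlinarith [norm_nonneg (mob z u)]
  simpa using this

theorem one_sub_conj_mul_self_ne_zero {z : ℂ} (hz : z ∈ ball (0 : ℂ) 1) : 1 - conj z * z ≠ 0 :=
  one_sub_conj_mul_ne_zero hz hz

theorem one_sub_conj_mul_mob {z u : ℂ} (hz : z ∈ ball (0 : ℂ) 1) (hu : u ∈ ball (0 : ℂ) 1) :
    1 - conj z * mob z u = (1 - conj z * z) / (1 - conj z * u) := by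
  have h := one_sub_conj_mul_ne_zero hz hu
  rw [mob]
  field_simp
  ring

theorem mob_mob {z u : ℂ} (hz : z ∈ ball (0 : ℂ) 1) (hu : u ∈ ball (0 : ℂ) 1) :
    mob z (mob z u) = u := by
  have h := one_sub_conj_mul_ne_zero hz hu
  have h' := one_sub_conj_mul_self_ne_zero hz
  rw [mob, one_sub_conj_mul_mob hz hu, mob]
  generalize conj z = c at h h' ⊢
  rw [div_div_eq_mul_div, div_eq_iff h', sub_mul, div_mul_cancel₀ _ h]
  ring

theorem image_mob_ball {z : ℂ} (hz : z ∈ ball (0 : ℂ) 1) : mob z '' ball 0 1 = ball 0 1 :=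
  Subset.antisymm (image_subset_iff.2 fun _ hu => mob_mem hz hu)
    fun u hu => ⟨mob z u, mob_mem hz hu, mob_mob hz hu⟩

theorem injOn_mob {z : ℂ} (hz : z ∈ ball (0 : ℂ) 1) : InjOn (mob z) (ball 0 1) :=
  fun u hu v hv h => by rw [← mob_mob hz hu, h, mob_mob hz hv]

theorem hasDerivAt_mob {z u : ℂ} (hz : z ∈ ball (0 : ℂ) 1) (hu : u ∈ ball (0 : ℂ) 1) :
    HasDerivAt (mob z) (-(1 - conj z * z) / (1 - conj z * u) ^ 2) u := by
  have h := one_sub_conj_mul_ne_zero hz hu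
  have h1 : HasDerivAt (fun u => z - u) (-1) u := by simpa using (hasDerivAt_id u).const_sub z
  have h2 : HasDerivAt (fun u => 1 - conj z * u) (-(conj z * 1)) u :=
    ((hasDerivAt_id u).const_mul _).const_sub 1
  have h3 : -(1 - conj z * z) / (1 - conj z * u) ^ 2 =
      (-1 * (1 - conj z * u) - (z - u) * -(conj z * 1)) / (1 - conj z * u) ^ 2 := by ring
  rw [h3]
  exact h1.div h2 h

theorem norm_one_sub_conj_mul_self {z : ℂ} (hz : z ∈ ball (0 : ℂ) 1) :
    ‖1 - conj z * z‖ = 1 - ‖z‖ ^ 2 := by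
  rw [← Complex.normSq_eq_conj_mul_self, Complex.normSq_eq_norm_sq]
  have := one_sub_norm_sq_pos hz
  rw [← Complex.ofReal_one, ← Complex.ofReal_sub, Complex.norm_real, Real.norm_of_nonneg this.le]

/-- The real Jacobian determinant of multiplication by `a`. -/
theorem abs_det_restrictScalars_toSpanSingleton (a : ℂ) :
    |((ContinuousLinearMap.toSpanSingleton ℂ a).restrictScalars ℝ : ℂ →L[ℝ] ℂ).det| = ‖a‖ ^ 2 := by
  have h1 : (((ContinuousLinearMap.toSpanSingleton ℂ a).restrictScalars ℝ : ℂ →L[ℝ] ℂ) :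
      ℂ →ₗ[ℝ] ℂ) = Algebra.lmul ℝ ℂ a := by
    ext
    simp [mul_comm]
  rw [ContinuousLinearMap.det, h1, ← Algebra.norm_apply, Algebra.norm_complex_apply,
    Complex.normSq_eq_norm_sq, abs_of_nonneg (by positivity)]

theorem lintegral_ball_eq_lintegral_mob {z : ℂ} (hz : z ∈ ball (0 : ℂ) 1) (G : ℂ → ℝ≥0∞) :
    ∫⁻ w in ball (0 : ℂ) 1, G w = ∫⁻ u in ball (0 : ℂ) 1,
      ENNReal.ofReal (((1 - ‖z‖ ^ 2) / ‖1 - conj z * u‖ ^ 2) ^ 2) * G (mob z u) := by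
  have h := lintegral_image_eq_lintegral_abs_det_fderiv_mul volume measurableSet_ball
    (fun u hu => ((hasDerivAt_mob hz hu).hasFDerivAt.restrictScalars ℝ).hasFDerivWithinAt)
    (injOn_mob hz) G
  rw [image_mob_ball hz] at h
  rw [h]
  refine setLIntegral_congr_fun measurableSet_ball fun u hu => ?_
  rw [abs_det_restrictScalars_toSpanSingleton, norm_div, norm_neg, norm_one_sub_conj_mul_self hz,
    norm_pow, div_pow]

/-- The Berezin kernel `((1 - |z|²) / |1 - z̄ u|²) ^ (2 + α)`, that is `(1 - |z|²)^(2 + α) |K^α_z(u)|²`: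
the density, with respect to `ω_α dA`, of the image of `ω_α dA` under `mob z`. -/
def berezinKernel (α : ℝ) (z u : ℂ) : ℝ := ((1 - ‖z‖ ^ 2) / ‖1 - conj z * u‖ ^ 2) ^ (2 + α)

theorem measurable_berezinKernel (α : ℝ) :
    Measurable fun p : ℂ × ℂ => berezinKernel α p.1 p.2 := by
  unfold berezinKernel; fun_prop

/-- The change of variables `w = mob z u` for the weighted measure. -/
theorem lintegral_comp_mob (α : ℝ) {z : ℂ} (hz : z ∈ ball (0 : ℂ) 1) {h : ℂ → ℝ≥0∞}
    (hh : Measurable h) :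
    ∫⁻ w, h (mob z w) ∂(weightedMeasure α) =
      ∫⁻ u, ENNReal.ofReal (berezinKernel α z u) * h u ∂(weightedMeasure α) := by
  have hm : Measurable fun u => berezinKernel α z u := by
    unfold berezinKernel; fun_prop
  rw [lintegral_weightedMeasure α (by fun_prop), lintegral_weightedMeasure α (by fun_prop),
    lintegral_ball_eq_lintegral_mob hz]
  congr 1
  refine setLIntegral_congr_fun measurableSet_ball fun u hu => ?_
  rw [mob_mob hz hu, ← mul_assoc, ← mul_assoc]
  congr 1
  have h1 := one_sub_norm_sq_pos hz
  have h2 := one_sub_norm_sq_pos hu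
  have h3 := norm_one_sub_conj_mul_pos hz hu
  rw [← ENNReal.ofReal_mul (by positivity), ← ENNReal.ofReal_mul' (by unfold berezinKernel; positivity)]
  congr 1
  rw [weight, weight, one_sub_norm_mob_sq hz hu, berezinKernel, add_comm 2 α,
    Real.rpow_add (by positivity), mul_div_right_comm, Real.mul_rpow (by positivity) h2.le,
    Real.rpow_two]
  ring

theorem lintegral_berezinKernel (α : ℝ) {z : ℂ} (hz : z ∈ ball (0 : ℂ) 1) :
    ∫⁻ u, ENNReal.ofReal (berezinKernel α z u) ∂(weightedMeasure α) = weightedMeasure α univ := by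
  simpa using (lintegral_comp_mob α hz (h := fun _ => 1) measurable_const).symm

theorem berezinKernel_nonneg (α : ℝ) {z : ℂ} (hz : z ∈ ball (0 : ℂ) 1) (u : ℂ) :
    0 ≤ berezinKernel α z u := by
  have := one_sub_norm_sq_pos hz
  unfold berezinKernel; positivity

/-- The Forelli–Rudin type estimate behind the averaging argument: for the weight of exponent
`2 α + 2` the Berezin kernel is the square of the one for `α`, so one factor is bounded trivially,
and the other one integrates to a constant after exchanging the roles of `z` and `w`. -/
theorem lintegral_berezinKernel_mul_weight_le {α : ℝ} (hα : -1 < α) {w : ℂ}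
    (hw : w ∈ ball (0 : ℂ) 1) :
    (∫⁻ z, ENNReal.ofReal (berezinKernel (2 * α + 2) z w) ∂(weightedMeasure α)) *
        ENNReal.ofReal (weight (2 * α + 2) w) ≤
      ENNReal.ofReal ((1 + (2 * α + 2)) / (1 + α) * 4 ^ (2 + α)) * weightedMeasure α univ *
        ENNReal.ofReal (weight α w) := by
  have hw1 := one_sub_norm_sq_pos hw
  have key : ∀ z ∈ ball (0 : ℂ) 1,
      berezinKernel (2 * α + 2) z w * weight (2 * α + 2) w ≤
        berezinKernel α w z * (((1 + (2 * α + 2)) / (1 + α) * 4 ^ (2 + α)) * weight α w) := by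
    intro z hz
    have hz1 := one_sub_norm_sq_pos hz
    have hd := norm_one_sub_conj_mul_pos hz hw
    have hα1 : 0 < 1 + α := by linarith
    set d := ‖1 - conj z * w‖ with hd_def
    have h1 : berezinKernel (2 * α + 2) z w * (1 - ‖w‖ ^ 2) ^ (2 + α) =
        berezinKernel α w z * (((1 - ‖z‖ ^ 2) / d) ^ 2) ^ (2 + α) := by
      rw [berezinKernel, berezinKernel, norm_one_sub_conj_mul_comm w z, ← hd_def,
        show 2 + (2 * α + 2) = 2 * (2 + α) by ring, Real.rpow_mul (by positivity), Real.rpow_two,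
        ← Real.mul_rpow (by positivity) (by positivity),
        ← Real.mul_rpow (by positivity) (by positivity)]
      congr 1
      field_simp
    have h2 : ((1 - ‖z‖ ^ 2) / d) ^ 2 ≤ 4 := by
      have h3 : (1 - ‖z‖ ^ 2) / d ≤ 2 := by
        rw [div_le_iff₀ hd]
        have h4 : 1 - ‖z‖ ≤ d := by
          have h5 := norm_sub_norm_le (1 : ℂ) (conj z * w)
          rw [norm_mul, RCLike.norm_conj, norm_one] at h5
          nlinarith [norm_nonneg z, norm_lt_one_of_mem hw]
        nlinarith [norm_nonneg z, norm_lt_one_of_mem hz]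
      have h6 : 0 ≤ (1 - ‖z‖ ^ 2) / d := by positivity
      nlinarith
    have h7 : weight (2 * α + 2) w =
        (1 + (2 * α + 2)) / (1 + α) * ((1 - ‖w‖ ^ 2) ^ (2 + α) * weight α w) := by
      rw [weight, weight, show 2 * α + 2 = (2 + α) + α by ring, Real.rpow_add hw1]
      field_simp
    have h8 := weight_pos hα hw
    have h9 := berezinKernel_nonneg α hw z
    calc berezinKernel (2 * α + 2) z w * weight (2 * α + 2) w
        = (1 + (2 * α + 2)) / (1 + α) * weight α w *
            (berezinKernel (2 * α + 2) z w * (1 - ‖w‖ ^ 2) ^ (2 + α)) := by rw [h7]; ring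
      _ = (1 + (2 * α + 2)) / (1 + α) * weight α w *
            (berezinKernel α w z * (((1 - ‖z‖ ^ 2) / d) ^ 2) ^ (2 + α)) := by rw [h1]
      _ ≤ (1 + (2 * α + 2)) / (1 + α) * weight α w * (berezinKernel α w z * 4 ^ (2 + α)) := by
          have : 0 ≤ 1 + (2 * α + 2) := by linarith
          gcongr
          linarith
      _ = _ := by ring
  have hc : 0 ≤ (1 + (2 * α + 2)) / (1 + α) * 4 ^ (2 + α) :=
    mul_nonneg (div_nonneg (by linarith) (by linarith)) (by positivity)
  rw [← lintegral_mul_const' _ _ ENNReal.ofReal_ne_top, mul_right_comm, ← ENNReal.ofReal_mul hc,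
    ← lintegral_berezinKernel α hw, ← lintegral_const_mul' _ _ ENNReal.ofReal_ne_top]
  refine lintegral_mono_ae ?_
  filter_upwards [ae_mem_ball α] with z hz
  rw [← ENNReal.ofReal_mul (berezinKernel_nonneg _ hz _),
    ← ENNReal.ofReal_mul' (berezinKernel_nonneg _ hw _), mul_comm (_ * weight α w)]
  exact ENNReal.ofReal_le_ofReal (key z hz)

/-- Averaging over the Möbius images of a weighted measure is bounded on nonnegative functions in
`L¹(ω_α)`, provided the averages use a sufficiently high weight exponent. -/
theorem exists_lintegral_lintegral_comp_mob_le {α : ℝ} (hα : -1 < α) :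
    ∃ C : ℝ≥0∞, C ≠ ∞ ∧ ∀ h : ℂ → ℝ≥0∞, Measurable h →
      ∫⁻ z, ∫⁻ u, h (mob z u) ∂(weightedMeasure (2 * α + 2)) ∂(weightedMeasure α) ≤
        C * ∫⁻ w, h w ∂(weightedMeasure α) := by
  have := isFiniteMeasure_weightedMeasure hα
  have := isFiniteMeasure_weightedMeasure (α := 2 * α + 2) (by linarith)
  refine ⟨ENNReal.ofReal ((1 + (2 * α + 2)) / (1 + α) * 4 ^ (2 + α)) * weightedMeasure α univ,
    ENNReal.mul_ne_top ENNReal.ofReal_ne_top (measure_ne_top _ _), fun h hh => ?_⟩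
  have hm : Measurable fun p : ℂ × ℂ => ENNReal.ofReal (berezinKernel (2 * α + 2) p.1 p.2) :=
    (measurable_berezinKernel _).ennreal_ofReal
  calc ∫⁻ z, ∫⁻ u, h (mob z u) ∂(weightedMeasure (2 * α + 2)) ∂(weightedMeasure α)
      = ∫⁻ z, ∫⁻ w, ENNReal.ofReal (berezinKernel (2 * α + 2) z w) * h w
          ∂(weightedMeasure (2 * α + 2)) ∂(weightedMeasure α) := by
        refine lintegral_congr_ae ?_
        filter_upwards [ae_mem_ball α] with z hz
        exact lintegral_comp_mob _ hz hh
    _ = ∫⁻ w, (∫⁻ z, ENNReal.ofReal (berezinKernel (2 * α + 2) z w) ∂(weightedMeasure α)) * h w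
          ∂(weightedMeasure (2 * α + 2)) := by
        rw [lintegral_lintegral_swap (hm.mul (hh.comp measurable_snd)).aemeasurable]
        refine lintegral_congr fun w => ?_
        exact lintegral_mul_const _ (by unfold berezinKernel; fun_prop)
    _ = ENNReal.ofReal Real.pi⁻¹ * ∫⁻ w in ball (0 : ℂ) 1,
          ((∫⁻ z, ENNReal.ofReal (berezinKernel (2 * α + 2) z w) ∂(weightedMeasure α)) *
            ENNReal.ofReal (weight (2 * α + 2) w)) * h w := by
        have hJ : Measurable fun w => ∫⁻ z, ENNReal.ofReal (berezinKernel (2 * α + 2) z w)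
            ∂(weightedMeasure α) := hm.lintegral_prod_left'
        rw [lintegral_weightedMeasure _ (hJ.fun_mul hh)]
        congr 1
        refine lintegral_congr fun w => ?_
        ring
    _ ≤ ENNReal.ofReal Real.pi⁻¹ * ∫⁻ w in ball (0 : ℂ) 1,
          (ENNReal.ofReal ((1 + (2 * α + 2)) / (1 + α) * 4 ^ (2 + α)) * weightedMeasure α univ) *
            (ENNReal.ofReal (weight α w) * h w) := by
        refine mul_le_mul_right ?_ _
        refine setLIntegral_mono' measurableSet_ball fun w hw => ?_
        rw [← mul_assoc]
        refine mul_le_mul_left ?_ _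
        exact lintegral_berezinKernel_mul_weight_le hα hw
    _ = _ := by
        rw [lintegral_const_mul _ (by fun_prop), lintegral_weightedMeasure _ hh]
        ring

/-! ### Invertibility of a compressed multiplication operator -/

theorem coeFn_mulOperator (α : ℝ) (φ : ℂ → ℝ) (hφ : MemLp φ ∞ (weightedMeasure α))
    (f : Lp ℂ 2 (weightedMeasure α)) :
    mulOperator α φ hφ f =ᵐ[weightedMeasure α] fun z => (φ z : ℂ) * f z := by
  have h1 := (ContinuousLinearMap.mul ℂ ℂ).coeFn_holder (r := 2)
    ((hφ.ofReal (K := ℂ)).toLp fun z => (φ z : ℂ)) f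
  have h2 := (hφ.ofReal (K := ℂ)).coeFn_toLp
  refine EventuallyEq.trans h1 ?_
  filter_upwards [h2] with z hz
  simp only [ContinuousLinearMap.mul_apply']
  exact congrArg (· * f z) hz

theorem enorm_sq_eq_lintegral {α : ℝ} (f : Lp ℂ 2 (weightedMeasure α)) :
    ‖f‖ₑ ^ 2 = ∫⁻ z, ‖f z‖ₑ ^ 2 ∂(weightedMeasure α) := by
  rw [Lp.enorm_def]
  have := eLpNorm_nnreal_pow_eq_lintegral (f := f) (μ := weightedMeasure α) (p := 2) (by simp)
  simpa using this

theorem memLp_two_of_lintegral_ne_top {α : ℝ} {f : ℂ → ℂ}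
    (hf : AEStronglyMeasurable f (weightedMeasure α))
    (h : ∫⁻ z, ‖f z‖ₑ ^ 2 ∂(weightedMeasure α) ≠ ∞) : MemLp f 2 (weightedMeasure α) := by
  refine ⟨hf, ?_⟩
  have h1 := eLpNorm_nnreal_pow_eq_lintegral (f := f) (μ := weightedMeasure α) (p := 2) (by simp)
  have h2 : eLpNorm f 2 (weightedMeasure α) ^ 2 = ∫⁻ z, ‖f z‖ₑ ^ 2 ∂(weightedMeasure α) := by
    simpa using h1
  rw [← h2] at h
  rw [lt_top_iff_ne_top]
  intro h3
  simp [h3] at h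

theorem exists_ae_norm_le {α : ℝ} {E : Type*} [NormedAddCommGroup E] {φ : ℂ → E}
    (hφ : MemLp φ ∞ (weightedMeasure α)) :
    ∃ B : ℝ, 0 < B ∧ ∀ᵐ z ∂(weightedMeasure α), ‖φ z‖ ≤ B := by
  have ht : eLpNormEssSup φ (weightedMeasure α) ≠ ∞ := by
    rw [← eLpNorm_exponent_top]; exact hφ.eLpNorm_ne_top
  refine ⟨(eLpNormEssSup φ (weightedMeasure α)).toReal + 1, by positivity, ?_⟩
  filter_upwards [ae_le_eLpNormEssSup (f := φ) (μ := weightedMeasure α)] with z hz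
  have := ENNReal.toReal_mono ht hz
  rw [toReal_enorm] at this
  linarith

theorem inner_mulOperator_self {α : ℝ} {φ : ℂ → ℝ} (hφ : MemLp φ ∞ (weightedMeasure α))
    (hφ0 : ∀ᵐ z ∂(weightedMeasure α), 0 ≤ φ z) (f : Lp ℂ 2 (weightedMeasure α)) :
    ‖inner ℂ (mulOperator α φ hφ f) f‖ₑ =
      ∫⁻ z, ENNReal.ofReal (φ z) * ‖f z‖ₑ ^ 2 ∂(weightedMeasure α) := by
  have h0 : 0 ≤ᵐ[weightedMeasure α] fun z => φ z * ‖f z‖ ^ 2 := by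
    filter_upwards [hφ0] with z hz
    positivity
  have h1 : inner ℂ (mulOperator α φ hφ f) f =
      ((∫ z, φ z * ‖f z‖ ^ 2 ∂(weightedMeasure α) : ℝ) : ℂ) := by
    rw [L2.inner_def]
    refine Eq.trans (integral_congr_ae ?_) integral_ofReal
    filter_upwards [coeFn_mulOperator α φ hφ f] with z hz
    rw [hz, RCLike.inner_apply, map_mul, Complex.conj_ofReal, mul_left_comm, Complex.mul_conj,
      Complex.normSq_eq_norm_sq]
    push_cast
    rfl
  have hint : Integrable (fun z => φ z * ‖f z‖ ^ 2) (weightedMeasure α) := by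
    obtain ⟨B, -, hB⟩ := exists_ae_norm_le hφ
    exact (Lp.memLp f).norm.integrable_sq.bdd_mul hφ.1 hB
  rw [h1, ← ofReal_norm, Complex.norm_real, Real.norm_of_nonneg (integral_nonneg_of_ae h0),
    ofReal_integral_eq_lintegral_ofReal hint h0]
  refine lintegral_congr_ae ?_
  filter_upwards [hφ0] with z hz
  rw [ENNReal.ofReal_mul hz, ENNReal.ofReal_pow (norm_nonneg _), ofReal_norm]

/-- The compression to a closed subspace of multiplication by a nonnegative bounded `φ` is
invertible if and only if its quadratic form is bounded below. -/
theorem isUnit_compression_iff {α : ℝ} {φ : ℂ → ℝ} (hφ : MemLp φ ∞ (weightedMeasure α))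
    (hφ0 : ∀ᵐ z ∂(weightedMeasure α), 0 ≤ φ z) (S : Submodule ℂ (Lp ℂ 2 (weightedMeasure α)))
    [CompleteSpace S] :
    IsUnit (S.orthogonalProjectionOnto ∘L mulOperator α φ hφ ∘L S.subtypeL) ↔
      ∃ C : ℝ≥0∞, C ≠ ∞ ∧ ∀ f ∈ S, ∫⁻ z, ‖f z‖ₑ ^ 2 ∂(weightedMeasure α) ≤
        C * ∫⁻ z, ENNReal.ofReal (φ z) * ‖f z‖ₑ ^ 2 ∂(weightedMeasure α) := by
  set T : S →L[ℂ] S := S.orthogonalProjectionOnto ∘L mulOperator α φ hφ ∘L S.subtypeL with hT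
  have hinner : ∀ x : S, inner ℂ (T x) x = inner ℂ (mulOperator α φ hφ x) (x : Lp ℂ 2 _) := by
    intro x
    rw [hT, ContinuousLinearMap.comp_apply, ContinuousLinearMap.comp_apply,
      Submodule.inner_orthogonalProjectionOnto_eq_of_mem_right]
    rfl
  constructor
  · rintro ⟨U, hU⟩
    obtain ⟨B, hB0, hB⟩ := exists_ae_norm_le hφ
    set V : S →L[ℂ] S := (U⁻¹ : (S →L[ℂ] S)ˣ).val with hV
    refine ⟨‖V‖ₑ ^ 2 * ENNReal.ofReal B, ENNReal.mul_ne_top (by simp) ENNReal.ofReal_ne_top,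
      fun f hf => ?_⟩
    have h1 : ‖f‖ₑ ≤ ‖V‖ₑ * ‖mulOperator α φ hφ f‖ₑ := by
      have h2 : V (T ⟨f, hf⟩) = ⟨f, hf⟩ := by
        have := congrArg (fun A : S →L[ℂ] S => A ⟨f, hf⟩) U.inv_mul
        rw [hU] at this
        simpa using this
      calc ‖f‖ₑ = ‖V (T ⟨f, hf⟩)‖ₑ := by rw [h2]; rfl
        _ ≤ ‖V‖ₑ * ‖T ⟨f, hf⟩‖ₑ := V.le_opENorm _
        _ ≤ _ := by
          gcongr
          rw [enorm_le_iff_norm_le]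
          exact S.norm_orthogonalProjectionOnto_apply_le _
    calc ∫⁻ z, ‖f z‖ₑ ^ 2 ∂(weightedMeasure α) = ‖f‖ₑ ^ 2 := (enorm_sq_eq_lintegral f).symm
      _ ≤ (‖V‖ₑ * ‖mulOperator α φ hφ f‖ₑ) ^ 2 := by gcongr
      _ = ‖V‖ₑ ^ 2 * ∫⁻ z, ‖mulOperator α φ hφ f z‖ₑ ^ 2 ∂(weightedMeasure α) := by
        rw [mul_pow, enorm_sq_eq_lintegral]
      _ ≤ ‖V‖ₑ ^ 2 * ∫⁻ z, ENNReal.ofReal B * (ENNReal.ofReal (φ z) * ‖f z‖ₑ ^ 2)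
            ∂(weightedMeasure α) := by
        refine mul_le_mul_right ?_ _
        refine lintegral_mono_ae ?_
        filter_upwards [coeFn_mulOperator α φ hφ f, hB, hφ0] with z hz hz1 hz2
        rw [Real.norm_of_nonneg hz2] at hz1
        rw [hz, enorm_mul, mul_pow, ← mul_assoc, sq ‖(φ z : ℂ)‖ₑ]
        have h3 : ‖(φ z : ℂ)‖ₑ = ENNReal.ofReal (φ z) := by
          rw [← ofReal_norm, Complex.norm_real, Real.norm_of_nonneg hz2]
        rw [h3]
        gcongr
      _ = _ := by rw [lintegral_const_mul' _ _ ENNReal.ofReal_ne_top, mul_assoc]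
  · rintro ⟨C, hC, h⟩
    refine ContinuousLinearMap.isUnit_of_forall_le_norm_inner_map T
      (c := (C.toNNReal + 1)⁻¹)
      (by positivity) fun x => ?_
    have h1 := h x x.2
    rw [← enorm_sq_eq_lintegral, ← inner_mulOperator_self hφ hφ0, ← hinner] at h1
    have h2 := ENNReal.toReal_mono (ENNReal.mul_ne_top hC (by simp)) h1
    rw [ENNReal.toReal_mul, ENNReal.toReal_pow, toReal_enorm, toReal_enorm] at h2
    change ‖x‖ ^ 2 * (C.toReal + 1)⁻¹ ≤ _
    rw [← div_eq_mul_inv, div_le_iff₀ (by positivity)]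
    have h3 : ‖x‖ = ‖(x : Lp ℂ 2 (weightedMeasure α))‖ := rfl
    rw [h3]
    nlinarith [norm_nonneg (inner ℂ (T x) x)]

/-! ### Harmonic functions on the disk -/

theorem harmonicOnNhd_comp_mob {f : ℂ → ℂ} (hf : HarmonicOnNhd f (ball 0 1)) {z : ℂ}
    (hz : z ∈ ball (0 : ℂ) 1) : HarmonicOnNhd (fun u => f (mob z u)) (ball 0 1) := by
  have hana : ∀ u ∈ ball (0 : ℂ) 1, AnalyticAt ℂ (mob z) u := fun u hu =>
    DifferentiableOn.analyticAt (s := ball 0 1)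
      (fun v hv => (hasDerivAt_mob hz hv).differentiableAt.differentiableWithinAt)
      (isOpen_ball.mem_nhds hu)
  have hreal : ∀ v : ℂ → ℝ, HarmonicOnNhd v (ball 0 1) →
      HarmonicOnNhd (fun u => v (mob z u)) (ball 0 1) := by
    intro v hv
    obtain ⟨F, hF, hFv⟩ := hv.exists_analyticOnNhd_ball_re_eq
    intro u hu
    have h1 : AnalyticAt ℂ (fun u => F (mob z u)) u := (hF _ (mob_mem hz hu)).comp (hana u hu)
    refine (harmonicAt_congr_nhds ?_).2 h1.harmonicAt_re
    filter_upwards [isOpen_ball.mem_nhds hu] with w hw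
    exact (hFv (mob_mem hz hw)).symm
  have hre := hreal _ (hf.comp_CLM Complex.reCLM)
  have him := hreal _ (hf.comp_CLM Complex.imCLM)
  have h := (hre.comp_CLM Complex.ofRealCLM).add
    (him.comp_CLM ((Complex.I • ContinuousLinearMap.id ℂ ℂ).restrictScalars ℝ ∘L Complex.ofRealCLM))
  convert h using 1
  ext u
  simp [mul_comm Complex.I]

/-- The zero set of a harmonic function on the disk that does not vanish at the origin is a null
set, since on each ray the function is real-analytic and not identically zero. -/
theorem ae_ne_zero_of_harmonicOnNhd {f : ℂ → ℂ} (hf : HarmonicOnNhd f (ball 0 1)) (h0 : f 0 ≠ 0) :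
    ∀ᵐ z ∂(volume.restrict (ball (0 : ℂ) 1)), f z ≠ 0 := by
  set Z : Set ℂ := ball 0 1 ∩ f ⁻¹' {0} with hZ
  have hZm : MeasurableSet Z := by
    have h1 : IsOpen (ball 0 1 ∩ f ⁻¹' {0}ᶜ) :=
      hf.continuousOn.isOpen_inter_preimage isOpen_ball isOpen_compl_singleton
    have h2 : Z = ball 0 1 \ (ball 0 1 ∩ f ⁻¹' {0}ᶜ) := by
      ext z
      simp [hZ]
    rw [h2]
    exact measurableSet_ball.diff h1.measurableSet
  have hana0 : ∀ z ∈ ball (0 : ℂ) 1, AnalyticAt ℝ f z := by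
    intro z hz
    have h1 := HarmonicAt.analyticAt (hf.comp_CLM Complex.reCLM z hz)
    have h2 := HarmonicAt.analyticAt (hf.comp_CLM Complex.imCLM z hz)
    have h3 := ((Complex.ofRealCLM.analyticAt _).comp h1).add
      (((Complex.ofRealCLM.analyticAt _).comp h2).mul (analyticAt_const (v := Complex.I)))
    refine h3.congr (Eventually.of_forall fun w => ?_)
    simp
  have hray : ∀ θ : ℝ, ∀ᵐ s : ℝ ∂(volume.restrict (Ioi 0)), Complex.polarCoord.symm (s, θ) ∉ Z := by
    intro θ
    set e : ℂ := Complex.exp (θ * Complex.I) with he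
    have hana : AnalyticOnNhd ℝ (fun s : ℝ => f (s * e)) (Ioo (-1) 1) := by
      intro s hs
      have h1 : AnalyticAt ℝ (fun s : ℝ => (s : ℂ) * e) s :=
        (Complex.ofRealCLM.analyticAt s).mul analyticAt_const
      refine (hana0 _ ?_).comp h1
      simpa [he, Complex.norm_exp_ofReal_mul_I, abs_lt] using hs
    have hcod := hana.preimage_zero_mem_codiscreteWithin (x := 0) (by simpa using h0) (by simp)
      (isConnected_Ioo (by norm_num))
    have h1 := ae_restrict_le_codiscreteWithin (μ := (volume : Measure ℝ)) measurableSet_Ioo hcod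
    rw [mem_ae_iff, Measure.restrict_apply' measurableSet_Ioo] at h1
    refine ae_restrict_of_ae ?_
    rw [ae_iff]
    refine measure_mono_null (fun s hs => ?_) h1
    have h2 : Complex.polarCoord.symm (s, θ) = s * e := by
      rw [Complex.polarCoord_symm_apply, he, Complex.exp_mul_I]
      push_cast
      rfl
    simp only [mem_ofPred_eq, not_not, h2, hZ] at hs
    refine ⟨?_, ?_⟩
    · simpa using hs.2
    · simpa [he, Complex.norm_exp_ofReal_mul_I, abs_lt] using hs.1
  have hZ0 : volume Z = 0 := by
    rw [← lintegral_indicator_one hZm, ← Complex.lintegral_comp_polarCoord_symm]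
    have hm : Measurable fun p : ℝ × ℝ =>
        ENNReal.ofReal p.1 • Z.indicator (1 : ℂ → ℝ≥0∞) (Complex.polarCoord.symm p) := by
      simp only [Complex.polarCoord_symm_apply, smul_eq_mul]
      exact Measurable.mul (by fun_prop) ((measurable_one.indicator hZm).comp (by fun_prop))
    rw [polarCoord_target, Measure.volume_eq_prod, ← Measure.prod_restrict,
      lintegral_prod_symm _ hm.aemeasurable]
    refine lintegral_eq_zero_of_ae_eq_zero (ae_of_all _ fun θ => ?_)
    refine lintegral_eq_zero_of_ae_eq_zero ?_
    filter_upwards [hray θ] with s hs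
    simp only [indicator_of_notMem hs, smul_zero, Pi.zero_apply]
  rw [ae_restrict_iff' measurableSet_ball, ae_iff]
  convert hZ0 using 2
  ext z
  simp [hZ]

/-! ### The compactness estimate -/

theorem memLp_of_harmonicOnNhd {β : ℝ} {F : ℂ → ℂ} (hF : HarmonicOnNhd F (ball 0 1))
    (h : ∫⁻ u, ‖F u‖ₑ ^ 2 ∂(weightedMeasure β) ≠ ∞) : MemLp F 2 (weightedMeasure β) :=
  memLp_two_of_lintegral_ne_top
    ((hF.continuousOn.aestronglyMeasurable measurableSet_ball).mono_ac
      (weightedMeasure_absolutelyContinuous β)) h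

/-- Point evaluation at `z`, as a bounded functional on the harmonic Bergman space. -/
theorem exists_evaluation {β : ℝ} (hβ : -1 < β) {z : ℂ} (hz : z ∈ ball (0 : ℂ) 1) :
    ∃ e : harmonicBergman β →L[ℂ] ℂ, ∀ (f : harmonicBergman β) (g : ℂ → ℂ),
      HarmonicOnNhd g (ball 0 1) →
      (f : Lp ℂ 2 (weightedMeasure β)) =ᵐ[weightedMeasure β] g → e f = g z := by
  obtain ⟨C, hC, hle⟩ := exists_enorm_le_eLpNorm hβ (norm_lt_one_of_mem hz)
  have hzc : z ∈ closedBall (0 : ℂ) ‖z‖ := by simp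
  choose rep hrep hae using fun f : harmonicBergman β => f.2
  have huniq : ∀ (f : harmonicBergman β) (g : ℂ → ℂ), HarmonicOnNhd g (ball 0 1) →
      (f : Lp ℂ 2 (weightedMeasure β)) =ᵐ[weightedMeasure β] g → rep f z = g z := by
    intro f g hg hfg
    have h1 := hle (rep f - g) ((hrep f).sub hg) z hzc
    have h2 : rep f - g =ᵐ[weightedMeasure β] 0 := by
      filter_upwards [hae f, hfg] with w hw1 hw2
      simp [← hw1, ← hw2]
    rw [eLpNorm_congr_ae h2, eLpNorm_zero, mul_zero, nonpos_iff_eq_zero, enorm_eq_zero] at h1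
    exact sub_eq_zero.1 h1
  let l : harmonicBergman β →ₗ[ℂ] ℂ :=
    { toFun := fun f => rep f z
      map_add' := fun f₁ f₂ => huniq _ _ ((hrep f₁).add (hrep f₂))
        ((Lp.coeFn_add _ _).trans ((hae f₁).add (hae f₂)))
      map_smul' := fun c f => huniq _ _
        ((hrep f).comp_CLM ((c • ContinuousLinearMap.id ℂ ℂ).restrictScalars ℝ))
        ((Lp.coeFn_smul _ _).trans ((hae f).const_smul c)) }
  refine ⟨l.mkContinuous C.toReal fun f => ?_, fun f g hg hfg => huniq f g hg hfg⟩
  have h1 := hle (rep f) (hrep f) z hzc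
  rw [← eLpNorm_congr_ae (hae f), ← Lp.enorm_def] at h1
  have h2 := ENNReal.toReal_mono (ENNReal.mul_ne_top hC (by simp)) h1
  rwa [ENNReal.toReal_mul, toReal_enorm, toReal_enorm] at h2

/-- Bounded sequences in a separable Hilbert space have weakly convergent subsequences. -/
theorem exists_subseq_tendsto_weakly {H : Type*} [NormedAddCommGroup H] [InnerProductSpace ℂ H]
    [CompleteSpace H] [TopologicalSpace.SeparableSpace H] {x : ℕ → H} {M : ℝ}
    (hx : ∀ n, ‖x n‖ ≤ M) :
    ∃ (y : H) (s : ℕ → ℕ), StrictMono s ∧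
      ∀ e : H →L[ℂ] ℂ, Tendsto (fun n => e (x (s n))) atTop (𝓝 (e y)) := by
  obtain ⟨ψ, -, s, hs, hlim⟩ := WeakDual.isSeqCompact_closedBall ℂ H 0 M
    (x := fun n => StrongDual.toWeakDual (InnerProductSpace.toDual ℂ H (x n)))
    (fun n => by simpa using hx n)
  refine ⟨(InnerProductSpace.toDual ℂ H).symm (WeakDual.toStrongDual ψ), s, hs, fun e => ?_⟩
  have h1 : ∀ y : H, e y =
      conj (inner ℂ y ((InnerProductSpace.toDual ℂ H).symm e)) := by
    intro y
    rw [inner_conj_symm, InnerProductSpace.toDual_symm_apply]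
  simp_rw [h1]
  refine (Complex.continuous_conj.tendsto _).comp ?_
  have h2 := (WeakDual.eval_continuous ((InnerProductSpace.toDual ℂ H).symm e)).seqContinuous hlim
  rw [InnerProductSpace.toDual_symm_apply]
  exact h2

theorem separableSpace_harmonicBergman {β : ℝ} (hβ : -1 < β) :
    TopologicalSpace.SeparableSpace (harmonicBergman β) := by
  have := isFiniteMeasure_weightedMeasure hβ
  have : Fact ((2 : ℝ≥0∞) ≠ ∞) := ⟨by simp⟩
  have : SecondCountableTopology (Lp ℂ 2 (weightedMeasure β)) := inferInstance
  infer_instance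

/-- The harmonic Bergman spaces have the Montel property, in pointwise form. -/
theorem exists_subseq_tendsto_of_lintegral_le {β : ℝ} (hβ : -1 < β) {G : ℕ → ℂ → ℂ}
    (hG : ∀ n, HarmonicOnNhd (G n) (ball 0 1)) {M : ℝ≥0∞} (hM : M ≠ ∞)
    (hGM : ∀ n, ∫⁻ u, ‖G n u‖ₑ ^ 2 ∂(weightedMeasure β) ≤ M) :
    ∃ (F : ℂ → ℂ) (s : ℕ → ℕ), HarmonicOnNhd F (ball 0 1) ∧ StrictMono s ∧
      ∀ u ∈ ball (0 : ℂ) 1, Tendsto (fun n => G (s n) u) atTop (𝓝 (F u)) := by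
  have hmem := fun n => memLp_of_harmonicOnNhd (hG n) (ne_top_of_le_ne_top hM (hGM n))
  set x : ℕ → harmonicBergman β := fun n => ⟨(hmem n).toLp (G n), G n, hG n, (hmem n).coeFn_toLp⟩
  have hx : ∀ n, ‖x n‖ ≤ √M.toReal := by
    intro n
    refine Real.le_sqrt_of_sq_le ?_
    have h1 : ‖(x n : Lp ℂ 2 (weightedMeasure β))‖ₑ ^ 2 ≤ M := by
      rw [enorm_sq_eq_lintegral]
      refine le_trans (le_of_eq (lintegral_congr_ae ?_)) (hGM n)
      filter_upwards [(hmem n).coeFn_toLp] with u hu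
      rw [hu]
    have h2 := ENNReal.toReal_mono hM h1
    rwa [ENNReal.toReal_pow, toReal_enorm] at h2
  have := separableSpace_harmonicBergman hβ
  obtain ⟨y, s, hs, hlim⟩ := exists_subseq_tendsto_weakly hx
  obtain ⟨F, hF, hyF⟩ := y.2
  refine ⟨F, s, hF, hs, fun u hu => ?_⟩
  obtain ⟨e, he⟩ := exists_evaluation hβ hu
  have h := hlim e
  rw [he y F hF hyF] at h
  refine h.congr fun n => ?_
  exact he _ _ (hG _) (hmem _).coeFn_toLp

/-- A function harmonic on the disk is controlled at the origin by a small multiple of its norm and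
by its mass against any density `g` that is not too small: otherwise a weak limit of
counterexamples would be a harmonic function that is nonzero at the origin and vanishes on a set
of positive measure. -/
theorem exists_enorm_zero_sq_le {α β : ℝ} (hα : -1 < α) (hβ : -1 < β) {B δ ε : ℝ≥0∞} (hB : B ≠ ∞)
    (hδ : δ ≠ 0) (hε : ε ≠ 0) :
    ∃ C : ℝ≥0∞, C ≠ ∞ ∧ ∀ (F : ℂ → ℂ) (g : ℂ → ℝ≥0∞), HarmonicOnNhd F (ball 0 1) → Measurable g →
      (∀ u, g u ≤ B) → δ ≤ ∫⁻ u, g u ∂(weightedMeasure α) →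
      ‖F 0‖ₑ ^ 2 ≤ ε * ∫⁻ u, ‖F u‖ₑ ^ 2 ∂(weightedMeasure β) +
        C * ∫⁻ u, g u * ‖F u‖ₑ ^ 2 ∂(weightedMeasure β) := by
  have := isFiniteMeasure_weightedMeasure hα
  have := isFiniteMeasure_weightedMeasure hβ
  by_contra! hcon
  choose F g hF hg hgB hgδ hlt using fun n : ℕ => hcon n (ENNReal.natCast_ne_top n)
  have hF0 : ∀ n, F n 0 ≠ 0 := fun n h => by
    have := hlt n
    simp [h] at this
  set G : ℕ → ℂ → ℂ := fun n u => (F n 0)⁻¹ * F n u with hGdef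
  have hG : ∀ n, HarmonicOnNhd (G n) (ball 0 1) := fun n =>
    (hF n).comp_CLM (((F n 0)⁻¹ • ContinuousLinearMap.id ℂ ℂ).restrictScalars ℝ)
  have hG0 : ∀ n, G n 0 = 1 := fun n => inv_mul_cancel₀ (hF0 n)
  have hGlt : ∀ n : ℕ, ε * ∫⁻ u, ‖G n u‖ₑ ^ 2 ∂(weightedMeasure β) +
      n * ∫⁻ u, g n u * ‖G n u‖ₑ ^ 2 ∂(weightedMeasure β) ≤ 1 := by
    intro n
    set c : ℝ≥0∞ := ‖(F n 0)⁻¹‖ₑ ^ 2 with hc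
    have hct : c ≠ ∞ := by simp [hc]
    have h1 : ∀ u, ‖G n u‖ₑ ^ 2 = c * ‖F n u‖ₑ ^ 2 := fun u => by
      rw [hGdef, enorm_mul, mul_pow]
    simp_rw [h1, mul_left_comm (g n _) c, lintegral_const_mul' _ _ hct]
    rw [mul_left_comm ε, mul_left_comm (n : ℝ≥0∞), ← mul_add]
    refine (mul_le_mul_right (hlt n).le c).trans (le_of_eq ?_)
    rw [← h1, hG0]
    simp
  obtain ⟨F', s, hF', hs, hlim⟩ := exists_subseq_tendsto_of_lintegral_le hβ hG
    (M := ε⁻¹) (by simpa using hε) fun n => by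
      rw [ENNReal.le_inv_iff_mul_le, mul_comm]
      exact le_self_add.trans (hGlt n)
  have hF'0 : F' 0 = 1 := by
    have h := hlim 0 (by simp)
    simp only [hG0] at h
    exact (tendsto_nhds_unique h tendsto_const_nhds)
  have hne : ∀ᵐ u ∂(weightedMeasure β), F' u ≠ 0 :=
    (weightedMeasure_absolutelyContinuous β).ae_le
      (ae_ne_zero_of_harmonicOnNhd hF' (by simp [hF'0]))
  have hmeas : ∀ f : ℂ → ℂ, HarmonicOnNhd f (ball 0 1) →
      AEMeasurable (fun u => ‖f u‖ₑ ^ 2) (weightedMeasure β) := fun f hf =>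
    (((hf.continuousOn.aestronglyMeasurable measurableSet_ball).mono_ac
      (weightedMeasure_absolutelyContinuous β)).enorm).pow_const 2
  set ρ := (weightedMeasure α).rnDeriv (weightedMeasure β) with hρ
  have hρm : Measurable ρ := Measure.measurable_rnDeriv _ _
  have hρi : ∫⁻ u, ρ u ∂(weightedMeasure β) ≠ ∞ := (Measure.lintegral_rnDeriv_lt_top _ _).ne
  -- Compare `ρ` with `N ‖G n‖²`: the excess of `ρ` is paid for by the bound on `g`.
  have hle : ∀ N n : ℕ, δ ≤ N * ∫⁻ u, g n u * ‖G n u‖ₑ ^ 2 ∂(weightedMeasure β) +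
      B * ∫⁻ u, (ρ u - N * ‖G n u‖ₑ ^ 2) ∂(weightedMeasure β) := by
    intro N n
    calc δ ≤ ∫⁻ u, g n u ∂(weightedMeasure α) := hgδ n
      _ = ∫⁻ u, ρ u * g n u ∂(weightedMeasure β) :=
        (lintegral_rnDeriv_mul (weightedMeasure_absolutelyContinuous_weightedMeasure α hβ)
          (hg n).aemeasurable).symm
      _ ≤ ∫⁻ u, (N * (g n u * ‖G n u‖ₑ ^ 2) + B * (ρ u - N * ‖G n u‖ₑ ^ 2))
            ∂(weightedMeasure β) := by
        refine lintegral_mono fun u => ?_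
        calc ρ u * g n u ≤ (N * ‖G n u‖ₑ ^ 2 + (ρ u - N * ‖G n u‖ₑ ^ 2)) * g n u := by
              gcongr
              exact le_add_tsub
          _ = N * (g n u * ‖G n u‖ₑ ^ 2) + g n u * (ρ u - N * ‖G n u‖ₑ ^ 2) := by ring
          _ ≤ _ := by gcongr; exact hgB n u
      _ = _ := by
        rw [lintegral_add_left' (((hg n).aemeasurable.fun_mul (hmeas _ (hG n))).const_mul _),
          lintegral_const_mul' _ _ (ENNReal.natCast_ne_top N), lintegral_const_mul' _ _ hB]
  have hzero : Tendsto (fun n => ∫⁻ u, g (s n) u * ‖G (s n) u‖ₑ ^ 2 ∂(weightedMeasure β))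
      atTop (𝓝 0) := by
    have h1 : Tendsto (fun n => ∫⁻ u, g n u * ‖G n u‖ₑ ^ 2 ∂(weightedMeasure β)) atTop (𝓝 0) := by
      refine tendsto_of_tendsto_of_tendsto_of_le_of_le tendsto_const_nhds
        ENNReal.tendsto_inv_nat_nhds_zero (fun _ => zero_le) fun n => ?_
      rw [ENNReal.le_inv_iff_mul_le, mul_comm]
      exact le_add_self.trans (hGlt n)
    exact h1.comp hs.tendsto_atTop
  -- Let `n → ∞` along the subsequence: the term with `g` disappears.
  have hle' : ∀ N : ℕ, δ ≤ B * ∫⁻ u, (ρ u - N * ‖F' u‖ₑ ^ 2) ∂(weightedMeasure β) := by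
    intro N
    have h1 : Tendsto (fun n => ∫⁻ u, (ρ u - N * ‖G (s n) u‖ₑ ^ 2) ∂(weightedMeasure β)) atTop
        (𝓝 (∫⁻ u, (ρ u - N * ‖F' u‖ₑ ^ 2) ∂(weightedMeasure β))) := by
      refine tendsto_lintegral_of_dominated_convergence' ρ
        (fun n => hρm.aemeasurable.sub ((hmeas _ (hG _)).const_mul _))
        (fun n => ae_of_all _ fun u => tsub_le_self) hρi ?_
      filter_upwards [ae_mem_ball β] with u hu
      have hu' : ‖F' u‖ₑ ^ 2 ≠ ∞ := by simp
      refine ENNReal.Tendsto.sub tendsto_const_nhds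
        (ENNReal.Tendsto.const_mul ?_ (Or.inr (ENNReal.natCast_ne_top N)))
        (Or.inr (ENNReal.mul_ne_top (ENNReal.natCast_ne_top N) hu'))
      exact ((ENNReal.continuous_pow 2).tendsto _).comp ((hlim u hu).enorm)
    have h2 := (ENNReal.Tendsto.const_mul hzero (Or.inr (ENNReal.natCast_ne_top N))).add
      (ENNReal.Tendsto.const_mul h1 (Or.inr hB))
    rw [mul_zero, zero_add] at h2
    exact ge_of_tendsto' h2 fun n => hle N (s n)
  -- Let `N → ∞`: as `F'` is nonzero almost everywhere, `N ‖F'‖²` eventually exceeds `ρ`.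
  have h3 : Tendsto (fun N : ℕ => ∫⁻ u, (ρ u - N * ‖F' u‖ₑ ^ 2) ∂(weightedMeasure β)) atTop
      (𝓝 (∫⁻ _, 0 ∂(weightedMeasure β))) := by
    refine tendsto_lintegral_of_dominated_convergence' ρ
      (fun n => hρm.aemeasurable.sub ((hmeas _ hF').const_mul _))
      (fun n => ae_of_all _ fun u => tsub_le_self) hρi ?_
    filter_upwards [hne, Measure.rnDeriv_lt_top (weightedMeasure α) (weightedMeasure β)]
      with u hu1 hu2
    have h4 : Tendsto (fun N : ℕ => (N : ℝ≥0∞) * ‖F' u‖ₑ ^ 2) atTop (𝓝 ∞) := by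
      have := ENNReal.Tendsto.mul_const (b := ‖F' u‖ₑ ^ 2) ENNReal.tendsto_nat_nhds_top
        (Or.inl ENNReal.top_ne_zero)
      rwa [ENNReal.top_mul (by simpa using hu1)] at this
    refine tendsto_const_nhds.congr' ?_
    filter_upwards [h4.eventually (lt_mem_nhds hu2)] with N hN
    exact (tsub_eq_zero_of_le hN.le).symm
  have h5 := ge_of_tendsto' (ENNReal.Tendsto.const_mul h3 (Or.inr hB)) hle'
  simp at h5
  exact hδ h5

/-! ### From averages to a lower bound on the harmonic Bergman space -/

/-- If the averages of `ψ` over the Möbius images of `ω_α dA` are bounded below, then multiplication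
by `ψ` is bounded below on harmonic functions: transport the estimate at the origin to every point
`z` by `mob z`, and average over `z`. -/
theorem exists_lintegral_le_of_le_averages {α : ℝ} (hα : -1 < α) {ψ : ℂ → ℝ≥0∞} (hψ : Measurable ψ)
    {B δ : ℝ≥0∞} (hB : B ≠ ∞) (hψB : ∀ u, ψ u ≤ B) (hδ : δ ≠ 0)
    (h : ∀ᵐ z ∂(weightedMeasure α), δ ≤ ∫⁻ u, ψ (mob z u) ∂(weightedMeasure α)) :
    ∃ C : ℝ≥0∞, C ≠ ∞ ∧ ∀ f : ℂ → ℂ, HarmonicOnNhd f (ball 0 1) →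
      ∫⁻ z, ‖f z‖ₑ ^ 2 ∂(weightedMeasure α) ≠ ∞ →
      ∫⁻ z, ‖f z‖ₑ ^ 2 ∂(weightedMeasure α) ≤
        C * ∫⁻ z, ψ z * ‖f z‖ₑ ^ 2 ∂(weightedMeasure α) := by
  have hβ : -1 < 2 * α + 2 := by linarith
  have := isFiniteMeasure_weightedMeasure hα
  have := isFiniteMeasure_weightedMeasure hβ
  obtain ⟨C₁, hC₁, havg⟩ := exists_lintegral_lintegral_comp_mob_le hα
  -- The constant `ε` is chosen so that the first term in the estimate at the origin, once averaged,
  -- is at most half of the left-hand side.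
  obtain ⟨ε, hε, hεC⟩ : ∃ ε : ℝ≥0∞, ε ≠ 0 ∧ ε * C₁ ≤ 2⁻¹ := by
    refine ⟨(2 * (C₁ + 1))⁻¹, ENNReal.inv_ne_zero.2 (ENNReal.mul_ne_top (by simp) (by simp [hC₁])),
      ?_⟩
    rw [ENNReal.mul_inv (by simp) (by simp), mul_assoc]
    refine mul_le_of_le_one_right' ?_
    rw [mul_comm, ← div_eq_mul_inv]
    exact ENNReal.div_le_of_le_mul (by simp)
  obtain ⟨C₂, hC₂, hest⟩ := exists_enorm_zero_sq_le hα hβ hB hδ hε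
  refine ⟨2 * (C₂ * C₁), ENNReal.mul_ne_top (by simp) (ENNReal.mul_ne_top hC₂ hC₁),
    fun f hf hfin => ?_⟩
  set G : ℂ → ℝ≥0∞ := (ball (0 : ℂ) 1).indicator fun w => ‖f w‖ₑ ^ 2 with hG
  have hGm : Measurable G := by
    classical
    rw [hG, ← Set.piecewise_eq_indicator]
    exact ContinuousOn.measurable_piecewise
      ((ENNReal.continuous_pow 2).comp_continuousOn hf.continuousOn.enorm) continuousOn_const
      measurableSet_ball
  have hGf : ∀ w ∈ ball (0 : ℂ) 1, ‖f w‖ₑ ^ 2 = G w := fun w hw => by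
    rw [hG, indicator_of_mem hw]
  have hmob : Measurable fun p : ℂ × ℂ => mob p.1 p.2 := by unfold mob; fun_prop
  have hpt : ∀ᵐ z ∂(weightedMeasure α), G z ≤
      ε * ∫⁻ u, G (mob z u) ∂(weightedMeasure (2 * α + 2)) +
        C₂ * ∫⁻ u, ψ (mob z u) * G (mob z u) ∂(weightedMeasure (2 * α + 2)) := by
    filter_upwards [h, ae_mem_ball α] with z hz hzb
    have h1 := hest (fun u => f (mob z u)) (fun u => ψ (mob z u)) (harmonicOnNhd_comp_mob hf hzb)
      (hψ.comp (measurable_mob z)) (fun u => hψB _) hz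
    rw [mob_zero_right, hGf z hzb] at h1
    refine h1.trans (le_of_eq ?_)
    congr 2
    · refine lintegral_congr_ae ?_
      filter_upwards [ae_mem_ball (2 * α + 2)] with u hu
      rw [hGf _ (mob_mem hzb hu)]
    · refine lintegral_congr_ae ?_
      filter_upwards [ae_mem_ball (2 * α + 2)] with u hu
      rw [hGf _ (mob_mem hzb hu)]
  have hfG : ∫⁻ z, ‖f z‖ₑ ^ 2 ∂(weightedMeasure α) = ∫⁻ z, G z ∂(weightedMeasure α) := by
    refine lintegral_congr_ae ?_
    filter_upwards [ae_mem_ball α] with z hz using hGf z hz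
  have hψfG : ∫⁻ z, ψ z * ‖f z‖ₑ ^ 2 ∂(weightedMeasure α) =
      ∫⁻ z, ψ z * G z ∂(weightedMeasure α) := by
    refine lintegral_congr_ae ?_
    filter_upwards [ae_mem_ball α] with z hz
    rw [hGf z hz]
  rw [hfG] at hfin ⊢
  rw [hψfG]
  set X := ∫⁻ z, G z ∂(weightedMeasure α) with hX
  set Y := ∫⁻ z, ψ z * G z ∂(weightedMeasure α) with hY
  have hXY : X ≤ 2⁻¹ * X + C₂ * C₁ * Y := by
    calc X ≤ ∫⁻ z, (ε * ∫⁻ u, G (mob z u) ∂(weightedMeasure (2 * α + 2)) +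
          C₂ * ∫⁻ u, ψ (mob z u) * G (mob z u) ∂(weightedMeasure (2 * α + 2)))
            ∂(weightedMeasure α) := lintegral_mono_ae hpt
      _ = ε * ∫⁻ z, ∫⁻ u, G (mob z u) ∂(weightedMeasure (2 * α + 2)) ∂(weightedMeasure α) +
          C₂ * ∫⁻ z, ∫⁻ u, ψ (mob z u) * G (mob z u) ∂(weightedMeasure (2 * α + 2))
            ∂(weightedMeasure α) := by
        have hm1 : Measurable fun z => ∫⁻ u, G (mob z u) ∂(weightedMeasure (2 * α + 2)) :=
          (hGm.comp hmob).lintegral_prod_right'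
        have hm2 : Measurable fun z =>
            ∫⁻ u, ψ (mob z u) * G (mob z u) ∂(weightedMeasure (2 * α + 2)) :=
          ((hψ.comp hmob).mul (hGm.comp hmob)).lintegral_prod_right'
        rw [lintegral_add_left (hm1.const_mul ε), lintegral_const_mul _ hm1,
          lintegral_const_mul _ hm2]
      _ ≤ ε * (C₁ * X) + C₂ * (C₁ * Y) := by
        gcongr
        · exact havg G hGm
        · exact havg (fun w => ψ w * G w) (hψ.mul hGm)
      _ ≤ _ := by
        rw [← mul_assoc, ← mul_assoc]
        gcongr
  have h2 : 2⁻¹ * X ≤ C₂ * C₁ * Y := by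
    have h3 : 2⁻¹ * X ≠ ∞ := ENNReal.mul_ne_top (by simp) hfin
    rw [← ENNReal.add_le_add_iff_left h3]
    refine le_trans (le_of_eq ?_) hXY
    rw [← add_mul, ENNReal.inv_two_add_inv_two, one_mul]
  calc X = 2 * (2⁻¹ * X) := by
        rw [← mul_assoc, ENNReal.mul_inv_cancel (by simp) (by simp), one_mul]
    _ ≤ 2 * (C₂ * C₁ * Y) := by gcongr
    _ = _ := by ring

/-! ### Averages against squared kernels -/

/-- The average of `φ` with respect to the density `|k_z|²`, for a family `k` of kernels. Both
Berezin transforms are of this form. -/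
def kernelAverage (α : ℝ) (k : ℂ → ℂ → ℂ) (φ : ℂ → ℝ) (z : ℂ) : ℝ :=
  (∫ w, φ w * ‖k z w‖ ^ 2 ∂(weightedMeasure α)) / ∫ w, ‖k z w‖ ^ 2 ∂(weightedMeasure α)

theorem kernelAverage_nonneg {α : ℝ} (k : ℂ → ℂ → ℂ) {φ : ℂ → ℝ}
    (hφ0 : ∀ᵐ z ∂(weightedMeasure α), 0 ≤ φ z) (z : ℂ) : 0 ≤ kernelAverage α k φ z := by
  refine div_nonneg (integral_nonneg_of_ae ?_) (integral_nonneg fun w => by positivity)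
  filter_upwards [hφ0] with w hw
  simp only [Pi.zero_apply]
  positivity

theorem lintegral_mul_enorm_sq_le {α B : ℝ} {φ : ℂ → ℝ}
    (hB : ∀ᵐ z ∂(weightedMeasure α), ‖φ z‖ ≤ B) (f : ℂ → ℂ) :
    ∫⁻ w, ENNReal.ofReal (φ w) * ‖f w‖ₑ ^ 2 ∂(weightedMeasure α) ≤
      ENNReal.ofReal B * ∫⁻ w, ‖f w‖ₑ ^ 2 ∂(weightedMeasure α) := by
  rw [← lintegral_const_mul' _ _ ENNReal.ofReal_ne_top]
  refine lintegral_mono_ae ?_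
  filter_upwards [hB] with w hw
  gcongr
  exact (le_abs_self _).trans hw

/-- The defining quotient of `kernelAverage`, cleared of its denominator and stated with integrals in
`ℝ≥0∞`. -/
theorem ofReal_kernelAverage_mul {α : ℝ} {k : ℂ → ℂ → ℂ} {φ : ℂ → ℝ}
    (hφ : MemLp φ ∞ (weightedMeasure α)) (hφ0 : ∀ᵐ z ∂(weightedMeasure α), 0 ≤ φ z) {z : ℂ}
    (hk : AEStronglyMeasurable (k z) (weightedMeasure α))
    (hk0 : ∫⁻ w, ‖k z w‖ₑ ^ 2 ∂(weightedMeasure α) ≠ 0)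
    (hkt : ∫⁻ w, ‖k z w‖ₑ ^ 2 ∂(weightedMeasure α) ≠ ∞) :
    ENNReal.ofReal (kernelAverage α k φ z) * ∫⁻ w, ‖k z w‖ₑ ^ 2 ∂(weightedMeasure α) =
      ∫⁻ w, ENNReal.ofReal (φ w) * ‖k z w‖ₑ ^ 2 ∂(weightedMeasure α) := by
  have hk2 : AEStronglyMeasurable (fun w => ‖k z w‖ ^ 2) (weightedMeasure α) := hk.norm.pow 2
  have h1 : ∫ w, ‖k z w‖ ^ 2 ∂(weightedMeasure α) =
      (∫⁻ w, ‖k z w‖ₑ ^ 2 ∂(weightedMeasure α)).toReal := by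
    rw [integral_eq_lintegral_of_nonneg_ae (ae_of_all _ fun w => sq_nonneg _) hk2]
    congr 1
    refine lintegral_congr fun w => ?_
    rw [ENNReal.ofReal_pow (norm_nonneg _), ofReal_norm]
  have h2 : ∫ w, φ w * ‖k z w‖ ^ 2 ∂(weightedMeasure α) =
      (∫⁻ w, ENNReal.ofReal (φ w) * ‖k z w‖ₑ ^ 2 ∂(weightedMeasure α)).toReal := by
    rw [integral_eq_lintegral_of_nonneg_ae _ (hφ.1.fun_mul hk2)]
    · congr 1
      refine lintegral_congr_ae ?_
      filter_upwards [hφ0] with w hw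
      rw [ENNReal.ofReal_mul hw, ENNReal.ofReal_pow (norm_nonneg _), ofReal_norm]
    · filter_upwards [hφ0] with w hw
      simp only [Pi.zero_apply]
      positivity
  obtain ⟨B, -, hB⟩ := exists_ae_norm_le hφ
  have h3 := ne_top_of_le_ne_top (ENNReal.mul_ne_top ENNReal.ofReal_ne_top hkt)
    (lintegral_mul_enorm_sq_le hB (k z))
  rw [kernelAverage, h1, h2, ENNReal.ofReal_div_of_pos (ENNReal.toReal_pos hk0 hkt),
    ENNReal.ofReal_toReal h3, ENNReal.ofReal_toReal hkt, ENNReal.div_mul_cancel hk0 hkt]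

theorem aestronglyMeasurable_kernelAverage {α : ℝ} (hα : -1 < α) {k : ℂ → ℂ → ℂ} {φ : ℂ → ℝ}
    (hφ : MemLp φ ∞ (weightedMeasure α)) (hk : Measurable fun p : ℂ × ℂ => k p.1 p.2) :
    AEStronglyMeasurable (kernelAverage α k φ) (weightedMeasure α) := by
  have := isFiniteMeasure_weightedMeasure hα
  have hk2 : StronglyMeasurable fun p : ℂ × ℂ => ‖k p.1 p.2‖ ^ 2 :=
    (hk.norm.pow_const 2).stronglyMeasurable
  have h1 : kernelAverage α k φ = kernelAverage α k (hφ.1.mk φ) := by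
    ext z
    rw [kernelAverage, kernelAverage]
    congr 1
    refine integral_congr_ae ?_
    filter_upwards [hφ.1.ae_eq_mk] with w hw
    rw [hw]
  rw [h1]
  have h2 : StronglyMeasurable fun p : ℂ × ℂ => hφ.1.mk φ p.2 * ‖k p.1 p.2‖ ^ 2 :=
    (hφ.1.stronglyMeasurable_mk.comp_measurable measurable_snd).mul hk2
  have h3 := h2.integral_prod_right' (ν := weightedMeasure α)
  have h4 := hk2.integral_prod_right' (ν := weightedMeasure α)
  exact (h3.measurable.div h4.measurable).aestronglyMeasurable

/-- Averages of a bounded `φ` are bounded, so invertibility in `L^∞` is a lower bound. -/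
theorem invertibleInLinfty_kernelAverage_iff {α : ℝ} (hα : -1 < α) {k : ℂ → ℂ → ℂ} {φ : ℂ → ℝ}
    (hφ : MemLp φ ∞ (weightedMeasure α)) (hφ0 : ∀ᵐ z ∂(weightedMeasure α), 0 ≤ φ z)
    (hk : Measurable fun p : ℂ × ℂ => k p.1 p.2)
    (hk0 : ∀ z ∈ ball (0 : ℂ) 1, ∫⁻ w, ‖k z w‖ₑ ^ 2 ∂(weightedMeasure α) ≠ 0)
    (hkt : ∀ z ∈ ball (0 : ℂ) 1, ∫⁻ w, ‖k z w‖ₑ ^ 2 ∂(weightedMeasure α) ≠ ∞) :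
    InvertibleInLinfty α (kernelAverage α k φ) ↔ ∃ c : ℝ≥0∞, c ≠ 0 ∧
      ∀ᵐ z ∂(weightedMeasure α), c ≤ ENNReal.ofReal (kernelAverage α k φ z) := by
  have hm := aestronglyMeasurable_kernelAverage hα hφ hk
  constructor
  · rintro ⟨-, g, hg, hmul⟩
    obtain ⟨M, hM0, hM⟩ := exists_ae_norm_le hg
    refine ⟨ENNReal.ofReal M⁻¹, by simpa using hM0, ?_⟩
    filter_upwards [hmul, hM] with z hz1 hz2
    refine ENNReal.ofReal_le_ofReal ?_
    have h1 := congrArg norm hz1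
    rw [norm_mul, Complex.norm_real, Real.norm_of_nonneg (kernelAverage_nonneg k hφ0 z),
      norm_one] at h1
    rw [inv_le_iff_one_le_mul₀ hM0, ← h1]
    have := kernelAverage_nonneg k hφ0 z
    gcongr
  · rintro ⟨c, hc, hle⟩
    obtain ⟨B, hB0, hB⟩ := exists_ae_norm_le hφ
    have hc' : 0 < (min c 1).toReal := ENNReal.toReal_pos (by simp [hc]) (by simp)
    refine ⟨memLp_top_of_bound hm B ?_, fun z => ((kernelAverage α k φ z)⁻¹ : ℝ),
      memLp_top_of_bound (C := ((min c 1).toReal)⁻¹) ?_ ?_, ?_⟩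
    · filter_upwards [ae_mem_ball α] with z hz
      rw [Real.norm_of_nonneg (kernelAverage_nonneg k hφ0 z)]
      have h1 := ofReal_kernelAverage_mul hφ hφ0 (z := z)
        (hk.comp measurable_prodMk_left).aestronglyMeasurable (hk0 z hz) (hkt z hz)
      have h2 := h1.trans_le (lintegral_mul_enorm_sq_le hB (k z))
      rw [ENNReal.mul_le_mul_iff_left (hk0 z hz) (hkt z hz)] at h2
      exact (ENNReal.ofReal_le_ofReal_iff hB0.le).1 h2
    · exact Complex.continuous_ofReal.comp_aestronglyMeasurable
        (hm.aemeasurable.inv.aestronglyMeasurable)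
    · filter_upwards [hle] with z hz
      have h0 := kernelAverage_nonneg k hφ0 z
      rw [Complex.norm_real, Real.norm_of_nonneg (inv_nonneg.2 h0)]
      refine inv_anti₀ hc' (ENNReal.toReal_le_of_le_ofReal h0 ((min_le_left _ _).trans hz))
    · filter_upwards [hle] with z hz
      have h1 : 0 < kernelAverage α k φ z :=
        ENNReal.ofReal_pos.1 ((pos_iff_ne_zero.2 hc).trans_le hz)
      rw [← Complex.ofReal_mul, mul_inv_cancel₀ h1.ne', Complex.ofReal_one]

/-- A lower bound for the quadratic form of multiplication by `φ`, tested on the kernels, bounds the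
averages of `φ` below. -/
theorem exists_le_kernelAverage_of_forall {α : ℝ} {k : ℂ → ℂ → ℂ} {φ : ℂ → ℝ}
    (hφ : MemLp φ ∞ (weightedMeasure α)) (hφ0 : ∀ᵐ z ∂(weightedMeasure α), 0 ≤ φ z)
    (hk : ∀ z ∈ ball (0 : ℂ) 1, AEStronglyMeasurable (k z) (weightedMeasure α))
    (hk0 : ∀ z ∈ ball (0 : ℂ) 1, ∫⁻ w, ‖k z w‖ₑ ^ 2 ∂(weightedMeasure α) ≠ 0)
    (hkt : ∀ z ∈ ball (0 : ℂ) 1, ∫⁻ w, ‖k z w‖ₑ ^ 2 ∂(weightedMeasure α) ≠ ∞)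
    {C : ℝ≥0∞} (hC : C ≠ ∞)
    (h : ∀ z ∈ ball (0 : ℂ) 1, ∫⁻ w, ‖k z w‖ₑ ^ 2 ∂(weightedMeasure α) ≤
      C * ∫⁻ w, ENNReal.ofReal (φ w) * ‖k z w‖ₑ ^ 2 ∂(weightedMeasure α)) :
    ∃ c : ℝ≥0∞, c ≠ 0 ∧
      ∀ᵐ z ∂(weightedMeasure α), c ≤ ENNReal.ofReal (kernelAverage α k φ z) := by
  refine ⟨C⁻¹, ENNReal.inv_ne_zero.2 hC, ?_⟩
  filter_upwards [ae_mem_ball α] with z hz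
  have h1 := h z hz
  rw [← ofReal_kernelAverage_mul hφ hφ0 (hk z hz) (hk0 z hz) (hkt z hz), ← mul_assoc] at h1
  nth_rewrite 1 [← one_mul (∫⁻ w, ‖k z w‖ₑ ^ 2 ∂(weightedMeasure α))] at h1
  rw [ENNReal.mul_le_mul_iff_left (hk0 z hz) (hkt z hz)] at h1
  rw [ENNReal.inv_le_iff_le_mul (fun h => (ENNReal.ofReal_ne_top h).elim) (fun h => (hC h).elim)]
  exact h1

/-! ### The mean value property for the weighted measure -/

theorem measurePreserving_mul_weightedMeasure (α : ℝ) {a : ℂ} (ha : ‖a‖ = 1) :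
    MeasurePreserving (fun w => a * w) (weightedMeasure α) (weightedMeasure α) := by
  have hvol : MeasurePreserving (fun w : ℂ => a * w) volume volume :=
    (rotation ⟨a, by simpa [Submonoid.unitSphere] using ha⟩).measurePreserving
  refine ⟨by fun_prop, Measure.ext_of_lintegral _ fun h hh => ?_⟩
  rw [lintegral_map hh (by fun_prop), lintegral_weightedMeasure _ (by fun_prop),
    lintegral_weightedMeasure _ hh, ← lintegral_indicator measurableSet_ball,
    ← lintegral_indicator measurableSet_ball, ← hvol.lintegral_comp
      ((by fun_prop : Measurable fun w => ENNReal.ofReal (weight α w) * h w).indicator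
        measurableSet_ball)]
  congr 1
  refine lintegral_congr fun w => ?_
  have h1 : ‖a * w‖ = ‖w‖ := by rw [norm_mul, ha, one_mul]
  by_cases hw : w ∈ ball (0 : ℂ) 1
  · have hw' : a * w ∈ ball (0 : ℂ) 1 := by rw [mem_ball_zero_iff] at hw ⊢; rwa [h1]
    rw [indicator_of_mem hw, indicator_of_mem hw', weight, weight, h1]
  · have hw' : a * w ∉ ball (0 : ℂ) 1 := by rw [mem_ball_zero_iff] at hw ⊢; rwa [h1]
    rw [indicator_of_notMem hw, indicator_of_notMem hw']

/-- Integrating an analytic function against a radial measure evaluates it at the origin. -/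
theorem integral_weightedMeasure_of_differentiableOn {α : ℝ} (hα : -1 < α) {f : ℂ → ℂ}
    (hf : DifferentiableOn ℂ f (ball 0 1)) (hfm : Measurable f)
    (hfi : Integrable f (weightedMeasure α)) :
    ∫ w, f w ∂(weightedMeasure α) = (weightedMeasure α).real univ * f 0 := by
  have := isFiniteMeasure_weightedMeasure hα
  have hc : ∀ θ, ‖circleMap 0 1 θ‖ = 1 := fun θ => by simp
  set ν : Measure ℝ := volume.restrict (Ioc 0 (2 * Real.pi)) with hν
  have hm : Measurable fun p : ℝ × ℂ => f (circleMap 0 1 p.1 * p.2) := by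
    refine hfm.comp ?_
    have : Continuous fun p : ℝ × ℂ => circleMap 0 1 p.1 * p.2 := by fun_prop
    exact this.measurable
  have hrot : ∀ θ, ∫ w, f (circleMap 0 1 θ * w) ∂(weightedMeasure α) =
      ∫ w, f w ∂(weightedMeasure α) := fun θ => by
    have hp := measurePreserving_mul_weightedMeasure α (hc θ)
    conv_rhs => rw [← hp.map_eq]
    rw [integral_map (by fun_prop) hfm.aestronglyMeasurable]
  have hint : Integrable (fun p : ℝ × ℂ => f (circleMap 0 1 p.1 * p.2))
      (ν.prod (weightedMeasure α)) := by
    rw [integrable_prod_iff hm.aestronglyMeasurable]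
    refine ⟨ae_of_all _ fun θ => ?_, ?_⟩
    · exact (measurePreserving_mul_weightedMeasure α (hc θ)).integrable_comp_of_integrable hfi
    · have h1 : ∀ θ, ∫ w, ‖f (circleMap 0 1 θ * w)‖ ∂(weightedMeasure α) =
          ∫ w, ‖f w‖ ∂(weightedMeasure α) := fun θ => by
        have hp := measurePreserving_mul_weightedMeasure α (hc θ)
        conv_rhs => rw [← hp.map_eq]
        rw [integral_map (by fun_prop) hfm.norm.aestronglyMeasurable]
      simp only [h1]
      exact integrable_const _
  have hcirc : ∀ w ∈ ball (0 : ℂ) 1, ∫ θ, f (circleMap 0 1 θ * w) ∂ν = (2 * Real.pi : ℝ) * f 0 := by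
    intro w hw
    have hw1 := norm_lt_one_of_mem hw
    have h1 : Real.circleAverage (fun ζ => f (ζ * w)) 0 1 = f (0 * w) := by
      apply InnerProductSpace.HarmonicOnNhd.circleAverage_eq (f := fun ζ => f (ζ * w))
      intro ζ hζ
      have hζ1 : ‖ζ‖ ≤ 1 := by simpa using hζ
      have h2 : ζ * w ∈ ball (0 : ℂ) 1 := by
        rw [mem_ball_zero_iff, norm_mul]
        nlinarith [norm_nonneg w]
      have h3 : AnalyticAt ℂ (fun ζ => ζ * w) ζ := analyticAt_id.mul analyticAt_const
      exact (AnalyticAt.fun_comp (f := fun ζ => ζ * w)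
        (hf.analyticAt (isOpen_ball.mem_nhds h2)) h3).harmonicAt
    rw [Real.circleAverage_def, zero_mul, intervalIntegral.integral_of_le (by positivity)] at h1
    rw [← h1, Complex.real_smul, ← mul_assoc, ← Complex.ofReal_mul,
      mul_inv_cancel₀ (by positivity), Complex.ofReal_one, one_mul]
  have hswap := integral_integral_swap (f := fun θ w => f (circleMap 0 1 θ * w)) hint
  have h2 : ∫ w, ∫ θ, f (circleMap 0 1 θ * w) ∂ν ∂(weightedMeasure α) =
      ∫ _, (2 * Real.pi : ℝ) * f 0 ∂(weightedMeasure α) := by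
    refine integral_congr_ae ?_
    filter_upwards [ae_mem_ball α] with w hw using hcirc w hw
  rw [h2] at hswap
  simp only [hrot, integral_const] at hswap
  have h3 : ν.real univ = 2 * Real.pi := by
    rw [hν, measureReal_restrict_apply_univ, Real.volume_real_Ioc_of_le (by positivity), sub_zero]
  rw [h3, Complex.real_smul, Complex.real_smul, mul_left_comm] at hswap
  exact mul_left_cancel₀ (by simp [Real.pi_ne_zero]) hswap

/-! ### The reproducing kernels -/

theorem measurable_analyticKernel (α : ℝ) : Measurable fun p : ℂ × ℂ => analyticKernel α p.1 p.2 := by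
  unfold analyticKernel; fun_prop

theorem measurable_harmonicKernel (α : ℝ) : Measurable fun p : ℂ × ℂ => harmonicKernel α p.1 p.2 := by
  have := measurable_analyticKernel α
  unfold harmonicKernel
  fun_prop

theorem one_sub_conj_mul_mem_slitPlane {z w : ℂ} (hz : z ∈ ball (0 : ℂ) 1)
    (hw : w ∈ ball (0 : ℂ) 1) : 1 - conj z * w ∈ Complex.slitPlane := by
  refine Or.inl ?_
  have h1 := (Complex.re_le_norm (conj z * w)).trans_lt (norm_conj_mul_lt_one hz hw)
  rw [Complex.sub_re, Complex.one_re]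
  linarith

theorem differentiableOn_analyticKernel (α : ℝ) {z : ℂ} (hz : z ∈ ball (0 : ℂ) 1) :
    DifferentiableOn ℂ (analyticKernel α z) (ball 0 1) := by
  intro w hw
  have h0 := one_sub_conj_mul_mem_slitPlane hz hw
  have h1 : DifferentiableAt ℂ (fun w => (1 - conj z * w) ^ ((2 + α : ℝ) : ℂ)) w :=
    DifferentiableAt.cpow (by fun_prop) (by fun_prop) h0
  have h2 : (1 - conj z * w) ^ ((2 + α : ℝ) : ℂ) ≠ 0 := by
    rw [Complex.cpow_def_of_ne_zero (one_sub_conj_mul_ne_zero hz hw)]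
    exact Complex.exp_ne_zero _
  exact ((differentiableAt_const 1).div h1 h2).differentiableWithinAt

theorem harmonicOnNhd_harmonicKernel (α : ℝ) {z : ℂ} (hz : z ∈ ball (0 : ℂ) 1) :
    HarmonicOnNhd (harmonicKernel α z) (ball 0 1) := by
  intro w hw
  have h1 := (differentiableOn_analyticKernel α hz).analyticAt (isOpen_ball.mem_nhds hw)
  exact (h1.harmonicAt.add h1.harmonicAt_conj).sub (harmonicAt_const 1)

@[simp] theorem analyticKernel_zero_right (α : ℝ) (z : ℂ) : analyticKernel α z 0 = 1 := by
  simp [analyticKernel]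

theorem norm_analyticKernel (α : ℝ) (z w : ℂ) :
    ‖analyticKernel α z w‖ = (‖1 - conj z * w‖ ^ (2 + α))⁻¹ := by
  rw [analyticKernel, norm_div, norm_one, Complex.norm_cpow_real, one_div]

theorem berezinKernel_eq (α : ℝ) {z : ℂ} (hz : z ∈ ball (0 : ℂ) 1) (w : ℂ) :
    ENNReal.ofReal (berezinKernel α z w) =
      ENNReal.ofReal ((1 - ‖z‖ ^ 2) ^ (2 + α)) * ‖analyticKernel α z w‖ₑ ^ 2 := by
  have h1 := one_sub_norm_sq_pos hz
  rw [← ofReal_norm, ← ENNReal.ofReal_pow (norm_nonneg _), ← ENNReal.ofReal_mul (by positivity),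
    norm_analyticKernel, berezinKernel, Real.div_rpow h1.le (by positivity), inv_pow, div_eq_mul_inv,
    ← Real.rpow_natCast, ← Real.rpow_natCast, ← Real.rpow_mul (norm_nonneg _),
    ← Real.rpow_natCast (_ ^ (2 + α)), ← Real.rpow_mul (norm_nonneg _), mul_comm (2 + α)]

theorem ofReal_one_sub_norm_sq_rpow_ne_zero (α : ℝ) {z : ℂ} (hz : z ∈ ball (0 : ℂ) 1) :
    ENNReal.ofReal ((1 - ‖z‖ ^ 2) ^ (2 + α)) ≠ 0 := by
  simpa using Real.rpow_pos_of_pos (one_sub_norm_sq_pos hz) _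

theorem mul_lintegral_enorm_analyticKernel_sq (α : ℝ) {z : ℂ} (hz : z ∈ ball (0 : ℂ) 1) :
    ENNReal.ofReal ((1 - ‖z‖ ^ 2) ^ (2 + α)) *
      ∫⁻ w, ‖analyticKernel α z w‖ₑ ^ 2 ∂(weightedMeasure α) = weightedMeasure α univ := by
  rw [← lintegral_berezinKernel α hz, ← lintegral_const_mul' _ _ ENNReal.ofReal_ne_top]
  simp_rw [berezinKernel_eq α hz]

theorem lintegral_enorm_analyticKernel_sq_ne_zero {α : ℝ} (hα : -1 < α) {z : ℂ}
    (hz : z ∈ ball (0 : ℂ) 1) : ∫⁻ w, ‖analyticKernel α z w‖ₑ ^ 2 ∂(weightedMeasure α) ≠ 0 := by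
  intro h
  have := mul_lintegral_enorm_analyticKernel_sq α hz
  rw [h, mul_zero] at this
  exact weightedMeasure_univ_ne_zero hα this.symm

theorem lintegral_enorm_analyticKernel_sq_ne_top {α : ℝ} (hα : -1 < α) {z : ℂ}
    (hz : z ∈ ball (0 : ℂ) 1) : ∫⁻ w, ‖analyticKernel α z w‖ₑ ^ 2 ∂(weightedMeasure α) ≠ ∞ := by
  have := isFiniteMeasure_weightedMeasure hα
  intro h
  have h1 := mul_lintegral_enorm_analyticKernel_sq α hz
  rw [h, ENNReal.mul_top (ofReal_one_sub_norm_sq_rpow_ne_zero α hz)] at h1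
  exact measure_ne_top _ _ h1.symm

theorem enorm_harmonicKernel_sq_le {α : ℝ} (hα : -1 < α) {z w : ℂ} (hz : z ∈ ball (0 : ℂ) 1)
    (hw : w ∈ ball (0 : ℂ) 1) :
    ‖harmonicKernel α z w‖ₑ ^ 2 ≤
      ENNReal.ofReal ((2 + 2 ^ (2 + α)) ^ 2) * ‖analyticKernel α z w‖ₑ ^ 2 := by
  have h0 := norm_one_sub_conj_mul_pos hz hw
  have h1 : 1 ≤ 2 ^ (2 + α) * ‖analyticKernel α z w‖ := by
    rw [norm_analyticKernel, ← div_eq_mul_inv, one_le_div (by positivity)]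
    refine Real.rpow_le_rpow h0.le ?_ (by linarith)
    have := norm_sub_le (1 : ℂ) (conj z * w)
    rw [norm_one] at this
    linarith [norm_conj_mul_lt_one hz hw]
  have h2 : ‖harmonicKernel α z w‖ ≤ (2 + 2 ^ (2 + α)) * ‖analyticKernel α z w‖ := by
    calc ‖harmonicKernel α z w‖ ≤ ‖analyticKernel α z w + conj (analyticKernel α z w)‖ + ‖(1 : ℂ)‖ :=
          norm_sub_le _ _
      _ ≤ ‖analyticKernel α z w‖ + ‖analyticKernel α z w‖ + 1 := by
          rw [norm_one]
          gcongr
          exact (norm_add_le _ _).trans_eq (by rw [RCLike.norm_conj])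
      _ ≤ _ := by linarith
  rw [← ofReal_norm, ← ofReal_norm, ← ENNReal.ofReal_pow (norm_nonneg _),
    ← ENNReal.ofReal_pow (norm_nonneg _), ← ENNReal.ofReal_mul (by positivity), ← mul_pow]
  gcongr

/-- The harmonic kernel is at least as large in norm as the analytic one: pointwise
`|R|² - |K|² = |K - 1|² + 2 Re (K² - K)`, and the last term integrates to zero. -/
theorem lintegral_enorm_analyticKernel_sq_le {α : ℝ} (hα : -1 < α) {z : ℂ}
    (hz : z ∈ ball (0 : ℂ) 1) :
    ∫⁻ w, ‖analyticKernel α z w‖ₑ ^ 2 ∂(weightedMeasure α) ≤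
      ∫⁻ w, ‖harmonicKernel α z w‖ₑ ^ 2 ∂(weightedMeasure α) := by
  have := isFiniteMeasure_weightedMeasure hα
  set K := analyticKernel α z with hK
  set R := harmonicKernel α z with hR
  have hKm : Measurable K := by
    rw [hK]; unfold analyticKernel; fun_prop
  have hKL : MemLp K 2 (weightedMeasure α) :=
    memLp_two_of_lintegral_ne_top hKm.aestronglyMeasurable
      (lintegral_enorm_analyticKernel_sq_ne_top hα hz)
  have hRL : MemLp R 2 (weightedMeasure α) :=
    (hKL.add hKL.star).sub (memLp_const 1)
  have hKi : Integrable K (weightedMeasure α) := hKL.integrable (by norm_num)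
  have hK2i : Integrable (fun w => K w ^ 2) (weightedMeasure α) := by
    refine ((hKL.integrable_norm_pow (by norm_num)).congr' (hKm.pow_const 2).aestronglyMeasurable ?_)
    exact ae_of_all _ fun w => by simp
  have hzero : ∫ w, (K w ^ 2 - K w) ∂(weightedMeasure α) = 0 := by
    have h := integral_weightedMeasure_of_differentiableOn hα
      (((differentiableOn_analyticKernel α hz).pow 2).sub (differentiableOn_analyticKernel α hz))
      ((hKm.pow_const 2).sub hKm) (hK2i.sub hKi)
    simpa using h
  have hre : ∫ w, (K w ^ 2 - K w).re ∂(weightedMeasure α) = 0 := by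
    have h := integral_re (hK2i.sub hKi)
    simp only [Pi.sub_apply, hzero] at h
    simpa using h
  have key : ∫ w, ‖K w‖ ^ 2 ∂(weightedMeasure α) ≤ ∫ w, ‖R w‖ ^ 2 ∂(weightedMeasure α) := by
    have hK2 : Integrable (fun w => ‖K w‖ ^ 2) (weightedMeasure α) := hKL.norm.integrable_sq
    have hpt : ∀ w, ‖R w‖ ^ 2 = ‖K w‖ ^ 2 + ‖K w - 1‖ ^ 2 + 2 * (K w ^ 2 - K w).re := by
      intro w
      simp only [hR, harmonicKernel, ← hK, ← Complex.normSq_eq_norm_sq, Complex.normSq_apply]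
      simp [sq]
      ring
    have hK1 : Integrable (fun w => ‖K w - 1‖ ^ 2) (weightedMeasure α) :=
      (hKL.sub (memLp_const 1)).norm.integrable_sq
    have hri : Integrable (fun w => 2 * (K w ^ 2 - K w).re) (weightedMeasure α) :=
      (hK2i.sub hKi).re.const_mul 2
    simp_rw [hpt]
    rw [integral_add (hK2.fun_add hK1) hri, integral_add hK2 hK1, integral_const_mul, hre, mul_zero,
      add_zero]
    have : 0 ≤ ∫ w, ‖K w - 1‖ ^ 2 ∂(weightedMeasure α) := integral_nonneg fun w => sq_nonneg _
    linarith
  have hof : ∀ f : ℂ → ℂ, MemLp f 2 (weightedMeasure α) →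
      ∫⁻ w, ‖f w‖ₑ ^ 2 ∂(weightedMeasure α) =
        ENNReal.ofReal (∫ w, ‖f w‖ ^ 2 ∂(weightedMeasure α)) := by
    intro f hf
    rw [ofReal_integral_eq_lintegral_ofReal hf.norm.integrable_sq (ae_of_all _ fun w => sq_nonneg _)]
    refine lintegral_congr fun w => ?_
    rw [ENNReal.ofReal_pow (norm_nonneg _), ofReal_norm]
  rw [hof K hKL, hof R hRL]
  exact ENNReal.ofReal_le_ofReal key

end BergmanToeplitz

end

open BergmanToeplitz

theorem mainTheorem8 (α : ℝ) (hα : -1 < α) (φ : ℂ → ℝ)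
    (hφ : MemLp φ ∞ (BergmanToeplitz.weightedMeasure α))
    (hφ0 : ∀ᵐ z ∂(BergmanToeplitz.weightedMeasure α), 0 ≤ φ z) :
    [IsUnit (BergmanToeplitz.analyticToeplitz α φ hφ),
      IsUnit (BergmanToeplitz.harmonicToeplitz α φ hφ),
      BergmanToeplitz.InvertibleInLinfty α (BergmanToeplitz.analyticBerezin α φ),
      BergmanToeplitz.InvertibleInLinfty α (BergmanToeplitz.harmonicBerezin α φ)].TFAE := by
  have hK0 := fun z hz => lintegral_enorm_analyticKernel_sq_ne_zero hα (z := z) hz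
  have hKt := fun z hz => lintegral_enorm_analyticKernel_sq_ne_top hα (z := z) hz
  have hKm : ∀ z ∈ ball (0 : ℂ) 1,
      AEStronglyMeasurable (analyticKernel α z) (weightedMeasure α) := fun z hz =>
    ((differentiableOn_analyticKernel α hz).continuousOn.aestronglyMeasurable
      measurableSet_ball).mono_ac (weightedMeasure_absolutelyContinuous α)
  have hR0 : ∀ z ∈ ball (0 : ℂ) 1, ∫⁻ w, ‖harmonicKernel α z w‖ₑ ^ 2 ∂(weightedMeasure α) ≠ 0 :=
    fun z hz => ((pos_iff_ne_zero.2 (hK0 z hz)).trans_le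
      (lintegral_enorm_analyticKernel_sq_le hα hz)).ne'
  set M : ℝ≥0∞ := ENNReal.ofReal ((2 + 2 ^ (2 + α)) ^ 2) with hM
  have hM0 : M ≠ 0 := by
    have : (0 : ℝ) < (2 + 2 ^ (2 + α)) ^ 2 := by positivity
    simpa [hM] using this.ne'
  have hMt : M ≠ ∞ := ENNReal.ofReal_ne_top
  have hRt : ∀ z ∈ ball (0 : ℂ) 1, ∫⁻ w, ‖harmonicKernel α z w‖ₑ ^ 2 ∂(weightedMeasure α) ≠ ∞ := by
    intro z hz
    refine ne_top_of_le_ne_top (ENNReal.mul_ne_top hMt (hKt z hz)) ?_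
    rw [← lintegral_const_mul' _ _ hMt]
    refine lintegral_mono_ae ?_
    filter_upwards [ae_mem_ball α] with w hw using enorm_harmonicKernel_sq_le hα hz hw
  have hRm : ∀ z ∈ ball (0 : ℂ) 1,
      AEStronglyMeasurable (harmonicKernel α z) (weightedMeasure α) := fun z hz =>
    ((harmonicOnNhd_harmonicKernel α hz).continuousOn.aestronglyMeasurable
      measurableSet_ball).mono_ac (weightedMeasure_absolutelyContinuous α)
  have hA := isUnit_compression_iff hφ hφ0 (analyticBergman α)
  have hH := isUnit_compression_iff hφ hφ0 (harmonicBergman α)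
  have hKinv := invertibleInLinfty_kernelAverage_iff hα hφ hφ0 (measurable_analyticKernel α) hK0 hKt
  have hRinv := invertibleInLinfty_kernelAverage_iff hα hφ hφ0 (measurable_harmonicKernel α) hR0 hRt
  have htoLp : ∀ (f : ℂ → ℂ) (hf : MemLp f 2 (weightedMeasure α)) (u : ℂ → ℝ≥0∞),
      ∫⁻ w, u w * ‖hf.toLp f w‖ₑ ^ 2 ∂(weightedMeasure α) =
        ∫⁻ w, u w * ‖f w‖ₑ ^ 2 ∂(weightedMeasure α) := by
    intro f hf u
    refine lintegral_congr_ae ?_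
    filter_upwards [hf.coeFn_toLp] with w hw
    rw [hw]
  tfae_have 2 → 1 := fun h => by
    obtain ⟨C, hC, hle⟩ := hH.1 h
    refine hA.2 ⟨C, hC, fun f hf => hle f ?_⟩
    obtain ⟨g, hg, hfg⟩ := hf
    exact ⟨g, fun z hz => (hg.analyticAt (isOpen_ball.mem_nhds hz)).harmonicAt, hfg⟩
  tfae_have 1 → 3 := fun h => by
    obtain ⟨C, hC, hle⟩ := hA.1 h
    refine hKinv.2 (exists_le_kernelAverage_of_forall hφ hφ0 hKm hK0 hKt hC fun z hz => ?_)
    have hmem := memLp_two_of_lintegral_ne_top (hKm z hz) (hKt z hz)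
    have h1 := hle (hmem.toLp _) ⟨_, differentiableOn_analyticKernel α hz, hmem.coeFn_toLp⟩
    have h2 := htoLp _ hmem fun _ => 1
    simp only [one_mul] at h2
    rwa [h2, htoLp _ hmem] at h1
  tfae_have 2 → 4 := fun h => by
    obtain ⟨C, hC, hle⟩ := hH.1 h
    refine hRinv.2 (exists_le_kernelAverage_of_forall hφ hφ0 hRm hR0 hRt hC fun z hz => ?_)
    have hmem := memLp_two_of_lintegral_ne_top (hRm z hz) (hRt z hz)
    have h1 := hle (hmem.toLp _) ⟨_, harmonicOnNhd_harmonicKernel α hz, hmem.coeFn_toLp⟩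
    have h2 := htoLp _ hmem fun _ => 1
    simp only [one_mul] at h2
    rwa [h2, htoLp _ hmem] at h1
  tfae_have 4 → 3 := fun h => by
    obtain ⟨c, hc, hle⟩ := hRinv.1 h
    refine hKinv.2 ⟨M⁻¹ * c, mul_ne_zero (ENNReal.inv_ne_zero.2 hMt) hc, ?_⟩
    filter_upwards [hle, ae_mem_ball α] with z hz hzb
    rw [← ENNReal.mul_le_mul_iff_left (hK0 z hzb) (hKt z hzb),
      ofReal_kernelAverage_mul hφ hφ0 (hKm z hzb) (hK0 z hzb) (hKt z hzb), mul_assoc,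
      ENNReal.inv_mul_le_iff hM0 hMt]
    calc c * ∫⁻ w, ‖analyticKernel α z w‖ₑ ^ 2 ∂(weightedMeasure α)
        ≤ ENNReal.ofReal (kernelAverage α (harmonicKernel α) φ z) *
            ∫⁻ w, ‖harmonicKernel α z w‖ₑ ^ 2 ∂(weightedMeasure α) :=
          mul_le_mul' hz (lintegral_enorm_analyticKernel_sq_le hα hzb)
      _ = ∫⁻ w, ENNReal.ofReal (φ w) * ‖harmonicKernel α z w‖ₑ ^ 2 ∂(weightedMeasure α) :=
          ofReal_kernelAverage_mul hφ hφ0 (hRm z hzb) (hR0 z hzb) (hRt z hzb)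
      _ ≤ ∫⁻ w, M * (ENNReal.ofReal (φ w) * ‖analyticKernel α z w‖ₑ ^ 2) ∂(weightedMeasure α) := by
          refine lintegral_mono_ae ?_
          filter_upwards [ae_mem_ball α] with w hw
          rw [mul_left_comm]
          exact mul_le_mul_right (enorm_harmonicKernel_sq_le hα hzb hw) _
      _ = _ := lintegral_const_mul' _ _ hMt
  tfae_have 3 → 2 := fun h => by
    obtain ⟨c, hc, hle⟩ := hKinv.1 h
    obtain ⟨B, hB0, hB⟩ := exists_ae_norm_le hφ
    -- `ψ` is a version of `φ` that is measurable and bounded everywhere.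
    set ψ : ℂ → ℝ≥0∞ := fun z => min (ENNReal.ofReal (hφ.1.mk φ z)) (ENNReal.ofReal B) with hψ
    have hψm : Measurable ψ := by
      have := hφ.1.stronglyMeasurable_mk.measurable
      fun_prop
    have hψφ : ∀ᵐ z ∂(weightedMeasure α), ψ z = ENNReal.ofReal (φ z) := by
      filter_upwards [hφ.1.ae_eq_mk, hB] with z hz1 hz2
      rw [hψ]
      simp only [← hz1]
      exact min_eq_left (ENNReal.ofReal_le_ofReal ((le_abs_self _).trans hz2))
    have hcong : ∀ f : ℂ → ℂ, ∫⁻ w, ψ w * ‖f w‖ₑ ^ 2 ∂(weightedMeasure α) =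
        ∫⁻ w, ENNReal.ofReal (φ w) * ‖f w‖ₑ ^ 2 ∂(weightedMeasure α) := fun f => by
      refine lintegral_congr_ae ?_
      filter_upwards [hψφ] with w hw
      rw [hw]
    have havg : ∀ᵐ z ∂(weightedMeasure α),
        c * weightedMeasure α univ ≤ ∫⁻ u, ψ (mob z u) ∂(weightedMeasure α) := by
      filter_upwards [hle, ae_mem_ball α] with z hz hzb
      rw [lintegral_comp_mob α hzb hψm]
      simp_rw [berezinKernel_eq α hzb, mul_assoc]
      rw [lintegral_const_mul' _ _ ENNReal.ofReal_ne_top]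
      simp_rw [mul_comm _ (ψ _)]
      rw [hcong, ← ofReal_kernelAverage_mul hφ hφ0 (hKm z hzb) (hK0 z hzb) (hKt z hzb),
        mul_left_comm, mul_lintegral_enorm_analyticKernel_sq α hzb]
      gcongr
    obtain ⟨C, hC, hbound⟩ := exists_lintegral_le_of_le_averages hα hψm ENNReal.ofReal_ne_top
      (fun u => min_le_right _ _) (mul_ne_zero hc (weightedMeasure_univ_ne_zero hα)) havg
    refine hH.2 ⟨C, hC, fun f hf => ?_⟩
    obtain ⟨g, hg, hfg⟩ := hf
    have hfg2 : ∀ u : ℂ → ℝ≥0∞, ∫⁻ w, u w * ‖f w‖ₑ ^ 2 ∂(weightedMeasure α) =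
        ∫⁻ w, u w * ‖g w‖ₑ ^ 2 ∂(weightedMeasure α) := fun u => by
      refine lintegral_congr_ae ?_
      filter_upwards [hfg] with w hw
      rw [hw]
    have hfg1 := hfg2 fun _ => 1
    simp only [one_mul] at hfg1
    rw [hfg1, hfg2, ← hcong]
    refine hbound g hg ?_
    rw [← hfg1, ← enorm_sq_eq_lintegral]
    simp
  tfae_finish
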